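/- A $(k,n)$-coding scheme is a randomised encoder $\mathsf{Enc}:\{0,1\}^k\to\{0,1\}^n$ with a deterministic decoder $\mathsf{Dec}:\{0,1\}^n\to\{0,1\}^k\cup\{\bot\}$ such that $\Pr[\mathsf{Dec}(\mathsf{Enc}(\mathbf m))=\mathbf m]=1$ for every $\mathbf m$; its rate is $k/n$. For $0\le\rho_r,\rho_w\le 1$, let $\mathcal F^{[n],\rho_r,\rho_w}_{\mathrm{BIT}}$ be the set of all functions $f_{S_r,S_w,g}:\{0,1\}^n\to\{0,1\}^n$ where $S_r,S_w\subseteq[n]$ have sizes $\lfloor n\rho_r\rfloor$ and $\lfloor n\rho_w\rfloor$, where $g:\{0,1\}^{S_r}\to\{\mathsf{Set0},\mathsf{Set1},\mathsf{Keep},\mathsf{Flip}\}^{S_w}$ is arbitrary, and where $f_{S_r,S_w,g}(\mathbf x)$ is obtained from $\mathbf x$ by applying to the bit at each position $i\in S_w$ the bit function $g(\mathbf x_{S_r})_i$ and leaving the other bits unchanged. A $(k,n)$-coding scheme is strongly non-malleable with respect to a set $\mathcal F$ of such functions with exact security $\varepsilon$ if for all $f\in\mathcal F$ and all $\mathbf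 m_0,\mathbf m_1\in\{0,1\}^k$ the statistical distance of $\mathrm{StrongNM}^f_{\mathbf m_0}$ and $\mathrm{StrongNM}^f_{\mathbf m_1}$ is at most $\varepsilon$, where $\mathrm{StrongNM}^f_{\mathbf m}$ draws $\mathbf x\leftarrow\mathsf{Enc}(\mathbf m)$ and outputs the symbol $\mathsf{same}^*$ if $f(\mathbf x)=\mathbf x$ and $\mathsf{Dec}(f(\mathbf x))$ otherwise. Consider families of $(k,n(k))$-coding schemes, $k=0,1,2,\dots$, where the $k$-th scheme is strongly non-malleable with respect to $\mathcal F^{[n(k)],\rho_r,\rho_w}_{\mathrm{BIT}}$ with exact security $\varepsilon_k$. The rate achieved by a family is $\limsup_{k\to\infty}k/n(k)$. The strong capacity $C(\rho_r,\rho_w)$ is the supremum of the rates achieved by families with $\varepsilon_k\to0$, and $C_\varepsilon(\rho_r,\rho_w)$ is the supremum of the rates achieved by families with $\varepsilon_k=\varepsilon$ for all $k$ (the supremum of the empty set of rates is $0$). **Theorem 3.1.** Let $0\le\rho_r\le1$ and $0<\rho_w\le1$. Then $$C(\rho_r,\rho_w)=1-\rho_r,\qquad\text{and}\qquad C_\varepsilon(\rho_r,\rho_w)=1-\rho_r\quad\text{for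 every }\varepsilon\in(0,1).$$ Moreover, if $\rho_r<1$, the capacity is attained: there is a family as above with $\varepsilon_k\to0$ and $k/n(k)\to1-\rho_r$. -/

import Mathlib

open Filter Topology
open scoped ENNReal

namespace NMCode

/-- Binary words of length `n`. -/
abbrev Word (n : ℕ) : Type := Fin n → Bool

/-- A `(k, n)`-coding scheme: a randomised encoder, a deterministic decoder (where `none` is the
symbol `⊥`), and correctness `Pr[Dec (Enc m) = m] = 1`. -/
structure CodingScheme (k n : ℕ) where
  enc : Word k → PMF (Word n)
  dec : Word n → Option (Word k)
  correct : ∀ m : Word k, ((enc m).map dec) (some m) = 1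

/-- The four functions that tamper with one bit. -/
inductive BitFn : Type
  | set0
  | set1
  | keep
  | flip

/-- The action of a bit tampering function. -/
def BitFn.apply : BitFn → Bool → Bool
  | .set0, _ => false
  | .set1, _ => true
  | .keep, b => b
  | .flip, b => !b

/-- The tampering function `f_{Sr, Sw, g}`: it reads the positions in `Sr`, and applies to each
position in `Sw` the bit function that `g` selects from the values read; the positions outside
`Sw` are unchanged. -/
def tamper {n : ℕ} (Sr Sw : Finset (Fin n))
    (g : ({i // i ∈ Sr} → Bool) → ({i // i ∈ Sw} → BitFn)) (x : Word n) : Word n :=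
  fun i => if h : i ∈ Sw then (g (fun j => x j.1) ⟨i, h⟩).apply (x i) else x i

/-- Bit tampering with leakage at length `n`: the sets read and written have sizes `ρr * n` and
`ρw * n`, rounded down when these are not integers.  (Smaller sets give the same functions: `g`
may ignore values it has read, and may choose `keep`.) -/
def bitTamperingWithLeakage (n : ℕ) (ρr ρw : ℝ) : Set (Word n → Word n) :=
  {f | ∃ Sr Sw : Finset (Fin n), Sr.card = ⌊ρr * n⌋₊ ∧ Sw.card = ⌊ρw * n⌋₊ ∧
    ∃ g : ({i // i ∈ Sr} → Bool) → ({i // i ∈ Sw} → BitFn), f = tamper Sr Sw g}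

/-- Statistical (total variation) distance of two distributions on a finite set. -/
noncomputable def statDist {α : Type} [Fintype α] (p q : PMF α) : ℝ :=
  (1 / 2) * ∑ a, |(p a).toReal - (q a).toReal|

/-- The experiment `StrongNM_m^f`.  The outcome `none` is the symbol `same*`, and `some y` is the
value `y` of the decoder on the tampered word. -/
noncomputable def CodingScheme.strongNM {k n : ℕ} (C : CodingScheme k n) (f : Word n → Word n)
    (m : Word k) : PMF (Option (Option (Word k))) :=
  (C.enc m).map fun x => if f x = x then none else some (C.dec (f x))

/-- Strong non-malleability with respect to the family `𝓕`, with exact security `ε`. -/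
def CodingScheme.IsStronglyNonMalleable {k n : ℕ} (C : CodingScheme k n)
    (𝓕 : Set (Word n → Word n)) (ε : ℝ) : Prop :=
  ∀ m₀ m₁ : Word k, ∀ f ∈ 𝓕, statDist (C.strongNM f m₀) (C.strongNM f m₁) ≤ ε

/-- A family of `(k, n(k))`-coding schemes, one for every message length `k`. -/
structure CodeFamily where
  n : ℕ → ℕ
  scheme : ∀ k : ℕ, CodingScheme k (n k)

/-- The rate `k / n(k)` of the `k`-th scheme.  (Correctness forces `k ≤ n(k)`.) -/
noncomputable def CodeFamily.rate (C : CodeFamily) (k : ℕ) : ℝ≥0∞ := (k : ℝ≥0∞) / (C.n k : ℝ≥0∞)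

/-- The rate that a family achieves as `k` grows to infinity. -/
noncomputable def CodeFamily.achievedRate (C : CodeFamily) : ℝ≥0∞ := limsup C.rate atTop

/-- The `k`-th scheme is strongly non-malleable against bit tampering with leakage, with exact
security `ε k`, for every `k`. -/
def CodeFamily.IsStrongNMC (C : CodeFamily) (ρr ρw : ℝ) (ε : ℕ → ℝ) : Prop :=
  ∀ k, (C.scheme k).IsStronglyNonMalleable (bitTamperingWithLeakage (C.n k) ρr ρw) (ε k)

/-- The capacity under vanishing error: the supremum of the rates achieved by families whose
exact security tends to `0`.  (The supremum is taken in `[0, ∞]`, so it is `0` if there is no such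
family.) -/
noncomputable def strongCapacity (ρr ρw : ℝ) : ℝ≥0∞ :=
  ⨆ (C : CodeFamily) (_ : ∃ ε : ℕ → ℝ, Tendsto ε atTop (𝓝 0) ∧ C.IsStrongNMC ρr ρw ε),
    C.achievedRate

/-- The capacity under a fixed exact security `ε`. -/
noncomputable def strongCapacityWithError (ρr ρw ε : ℝ) : ℝ≥0∞ :=
  ⨆ (C : CodeFamily) (_ : C.IsStrongNMC ρr ρw fun _ => ε), C.achievedRate

end NMCode

/-!
Upper bound.  Let `S` be a set of `⌊ρr * n⌋` positions, and let `P m` be the distribution of the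
bits at `S` of an encoding of `m`.  A tampering function may flip some bits exactly if the bits read
lie in a set `T`; the outcome is `same*` exactly if they do not, so `ε`-security makes
`P m` and `P m₀` overlap in mass at least `1 - ε`.  As the decoder is deterministic, each value of
the bits at `S` is possible for at most `2 ^ (n - |S|)` messages.  Summing the overlaps with
one fixed `P m₀` over all messages gives `(1 - ε) * 2 ^ k ≤ 2 ^ (n - |S|)`
(`CodingScheme.IsStronglyNonMalleable.mul_two_pow_le`), which bounds the rate for each fixed `ε < 1`.

Existence.  Give each word of length `n` an independent uniform label in a set of `b = 2 ^ (k + u)`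
elements, of which `2 ^ k` stand for messages; encode a message by a random word of its label.  The
bits read split the words into subcubes ("blocks") of `2 ^ (n - ⌊ρr * n⌋) = 2 ^ (k + 8 * u)`
words, and on each block the tampering function acts bit by bit with fixed bit functions.  So only
`2 ^ O(n)` pairs of a block and a function on it have to be controlled, although the number of
tampering functions is doubly exponential.  On a block, call a moved word light if fewer than
`d = 2 ^ (k + 5 * u)` moved words share its image.  With high probability each of the following
parts of a block that has at least `d` words contains nearly its expected number of codewords of
each message: the fixed points, the light words, and each large fibre of moved words
(`card_labelling_fibre_lt_le`).  Moreover few light codewords are moved to codewords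
(`card_labelling_lt_pairs_le`): those whose `i`-th bit is changed from `β` are moved outside their
own set, so the labels of the images are independent of theirs.  Hence the outcome of each message
has, up to a small mass, the distribution given by the sizes of the parts: `same*` for fixed points,
`⊥` for light words, and the common decoded image for a large fibre.  This distribution does not
depend on the message (`statDist_strongNM_labelScheme_le`).  All events fail with probability at
most `exp (-4 ^ u / 4)`, so `u` of order `√k` is enough, and the rate tends to `1 - ρr`.
-/

namespace NMCode

/-! ### Tail bounds for random labellings -/

section Labelling

variable {V B : Type*} [Fintype V] [DecidableEq V] [Fintype B]

/-- The expectation of a product of functions of the independent labels of distinct words is the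
product of the expectations; all sums over labellings stand for unnormalised expectations. -/
theorem sum_prod_labelling [Nonempty B] (A : Finset V) (F : V → B → ℝ) :
    ∑ φ : V → B, ∏ x ∈ A, F x (φ x) =
      Fintype.card (V → B) * ∏ x ∈ A, ((∑ z, F x z) / Fintype.card B) := by
  have hb : (Fintype.card B : ℝ) ≠ 0 := by positivity
  have h1 : ∀ φ : V → B, ∏ x ∈ A, F x (φ x) = ∏ x, if x ∈ A then F x (φ x) else 1 := by
    intro φ; rw [Finset.prod_ite_mem, Finset.univ_inter]
  simp_rw [h1]
  have h2 := Finset.prod_univ_sum (fun _ : V => (Finset.univ : Finset B))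
    (fun x z => if x ∈ A then F x z else 1)
  rw [Fintype.piFinset_univ] at h2
  rw [← h2]
  have h3 : ∀ x : V, (∑ z : B, if x ∈ A then F x z else 1) =
      Fintype.card B * if x ∈ A then (∑ z, F x z) / Fintype.card B else 1 := by
    intro x
    split_ifs
    · field_simp
    · simp
  simp_rw [h3]
  rw [Finset.prod_mul_distrib, Finset.prod_ite_mem, Finset.univ_inter]
  simp

/-- The labels on `G` may be resampled independently: `(ψ, φ) ↦ (G.piecewise ψ φ, G.piecewise φ ψ)`
is an involution on pairs of labellings. -/
theorem sum_labelling_piecewise (G : Finset V) (F : (V → B) → ℝ) :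
    Fintype.card (V → B) * ∑ φ, F φ = ∑ ψ : V → B, ∑ φ : V → B, F (G.piecewise φ ψ) := by
  have h : ∑ p : (V → B) × (V → B), F (G.piecewise p.2 p.1) =
      ∑ p : (V → B) × (V → B), F p.2 := by
    refine Finset.sum_nbij' (fun p => (G.piecewise p.1 p.2, G.piecewise p.2 p.1))
      (fun p => (G.piecewise p.1 p.2, G.piecewise p.2 p.1)) ?_ ?_ ?_ ?_ ?_
    · simp
    · simp
    · rintro ⟨a, b⟩ -
      ext x <;> by_cases hx : x ∈ G <;> simp [hx]
    · rintro ⟨a, b⟩ -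
      ext x <;> by_cases hx : x ∈ G <;> simp [hx]
    · simp
  rw [Fintype.sum_prod_type, Fintype.sum_prod_type] at h
  rw [h]
  simp

/-- Markov's inequality for an exponential moment. -/
theorem card_mul_exp_le_sum_exp {Ω : Type*} [Fintype Ω] (P : Ω → Prop) [DecidablePred P]
    (Φ : Ω → ℝ) (w : ℝ) (h : ∀ ω, P ω → w ≤ Φ ω) :
    ((Finset.univ.filter P).card : ℝ) * Real.exp w ≤ ∑ ω, Real.exp (Φ ω) := by
  calc ((Finset.univ.filter P).card : ℝ) * Real.exp w
      = ∑ ω ∈ Finset.univ.filter P, Real.exp w := by simp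
    _ ≤ ∑ ω ∈ Finset.univ.filter P, Real.exp (Φ ω) := by
        apply Finset.sum_le_sum
        intro ω hω
        exact Real.exp_le_exp.2 (h ω (Finset.mem_filter.1 hω).2)
    _ ≤ _ := Finset.sum_le_univ_sum_of_nonneg fun ω => (Real.exp_pos _).le

theorem exp_mul_card_filter {α : Type*} (A : Finset α) (P : α → Prop) [DecidablePred P] (t : ℝ) :
    Real.exp (t * (A.filter P).card) = ∏ x ∈ A, if P x then Real.exp t else 1 := by
  rw [Finset.prod_ite, Finset.prod_const, Finset.prod_const_one, mul_one, ← Real.exp_nat_mul,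
    mul_comm]

variable [DecidableEq B]

/-- The exponential moment of the number of words in `A` of label `z`, bounded as for a Poisson
variable.  The exponent is proportional to the mean `|A| / |B|`, which can be far smaller than
`|A|`; a bound of Hoeffding type would be too weak here. -/
theorem sum_exp_mul_card_fibre_le [Nonempty B] (A : Finset V) (z : B) {t : ℝ} (ht : |t| ≤ 1) :
    ∑ φ : V → B, Real.exp (t * (A.filter fun x => φ x = z).card) ≤
      Fintype.card (V → B) * Real.exp ((t + t ^ 2) * (A.card / Fintype.card B)) := by
  have hb : (0 : ℝ) < Fintype.card B := by positivity
  simp_rw [exp_mul_card_filter]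
  rw [sum_prod_labelling A fun _ y => if y = z then Real.exp t else 1]
  have h1 : (∑ y : B, if y = z then Real.exp t else 1) = Fintype.card B + (Real.exp t - 1) := by
    have : ∀ y : B, (if y = z then Real.exp t else 1) =
        1 + if y = z then Real.exp t - 1 else 0 := by
      intro y; split_ifs <;> ring
    simp_rw [this]
    rw [Finset.sum_add_distrib, Finset.sum_ite_eq']
    simp
  rw [h1, Finset.prod_const]
  gcongr
  have h2 : ((Fintype.card B : ℝ) + (Real.exp t - 1)) / Fintype.card B ≤
      Real.exp ((t + t ^ 2) / Fintype.card B) := by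
    have := (abs_le.1 (Real.abs_exp_sub_one_sub_id_le ht)).2
    have h3 := Real.add_one_le_exp ((t + t ^ 2) / Fintype.card B)
    refine le_trans ?_ h3
    rw [add_div, div_self hb.ne', add_comm]
    gcongr
    linarith
  have h0 : 0 ≤ ((Fintype.card B : ℝ) + (Real.exp t - 1)) / Fintype.card B := by
    have : (1 : ℝ) ≤ Fintype.card B := by exact_mod_cast Fintype.card_pos
    have := Real.exp_pos t
    apply div_nonneg <;> linarith
  calc _ ≤ Real.exp ((t + t ^ 2) / Fintype.card B) ^ A.card := by gcongr
    _ = _ := by rw [← Real.exp_nat_mul]; congr 1; ring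

theorem card_le_of_mul_exp_le {a K w v : ℝ} (h : a * Real.exp w ≤ K * Real.exp v) :
    a ≤ K * Real.exp (v - w) := by
  rw [Real.exp_sub, ← mul_div_assoc, le_div_iff₀ (Real.exp_pos _)]
  exact h

/-- Lower tail: few labellings give `A` too few words of label `z`. -/
theorem card_labelling_fibre_lt_le [Nonempty B] (A : Finset V) (z : B) {η : ℝ} (h0 : 0 ≤ η)
    (h1 : η ≤ 1) :
    ((Finset.univ.filter fun φ : V → B =>
      ((A.filter fun x => φ x = z).card : ℝ) < (1 - η) * (A.card / Fintype.card B)).card : ℝ) ≤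
      Fintype.card (V → B) * Real.exp (-(η ^ 2 / 4 * (A.card / Fintype.card B))) := by
  have ht : |(-(η / 2))| ≤ 1 := by rw [abs_neg, abs_of_nonneg] <;> linarith
  have := (card_mul_exp_le_sum_exp (fun φ : V → B =>
      ((A.filter fun x => φ x = z).card : ℝ) < (1 - η) * (A.card / Fintype.card B))
      (fun φ => -(η / 2) * (A.filter fun x => φ x = z).card)
      (-(η / 2) * ((1 - η) * (A.card / Fintype.card B)))
      (fun φ hφ => by nlinarith)).trans (sum_exp_mul_card_fibre_le A z ht)
  convert card_le_of_mul_exp_le this using 3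
  ring

/-- Upper tail: few labellings give `A` too many words of label `z`. -/
theorem card_labelling_lt_fibre_le [Nonempty B] (A : Finset V) (z : B) {η : ℝ} (h0 : 0 ≤ η)
    (h1 : η ≤ 1) :
    ((Finset.univ.filter fun φ : V → B =>
      (1 + η) * (A.card / Fintype.card B) < ((A.filter fun x => φ x = z).card : ℝ)).card : ℝ) ≤
      Fintype.card (V → B) * Real.exp (-(η ^ 2 / 4 * (A.card / Fintype.card B))) := by
  have ht : |(η / 2)| ≤ 1 := by rw [abs_of_nonneg] <;> linarith
  have := (card_mul_exp_le_sum_exp (fun φ : V → B =>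
      (1 + η) * (A.card / Fintype.card B) < ((A.filter fun x => φ x = z).card : ℝ))
      (fun φ => (η / 2) * (A.filter fun x => φ x = z).card)
      ((η / 2) * ((1 + η) * (A.card / Fintype.card B)))
      (fun φ hφ => by nlinarith)).trans (sum_exp_mul_card_fibre_le A z ht)
  convert card_le_of_mul_exp_le this using 3
  ring

/-- The exponential moment of the number of words `x ∈ G` of label `z` such that the label of `h x`
lies in `Z`.  A single word may be the image of up to `d` words of `G`, so only parameters `t` of
order at most `|B| / d` are allowed. -/
theorem sum_exp_mul_card_pairs_le [Nonempty B] (G : Finset V) (h : V → V)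
    (hG : ∀ x ∈ G, h x ∉ G) (z : B) (Z : Finset B) {d : ℕ}
    (hd : ∀ y, (G.filter fun x => h x = y).card ≤ d) {t : ℝ} (ht0 : 0 ≤ t) (ht1 : t ≤ 1)
    (htd : 2 * t * (d / Fintype.card B) ≤ 1) :
    ∑ φ : V → B, Real.exp (t * (G.filter fun x => φ x = z ∧ φ (h x) ∈ Z).card) ≤
      Fintype.card (V → B) *
        Real.exp (4 * t * (Z.card / Fintype.card B) * (G.card / Fintype.card B)) := by
  have hb : (0 : ℝ) < Fintype.card B := by positivity
  have hN : (0 : ℝ) < Fintype.card (V → B) := by positivity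
  set b : ℝ := (Fintype.card B : ℝ) with hbdef
  set c : ℝ := Real.exp t - 1 with hc
  have hc0 : 0 ≤ c := by have := Real.add_one_le_exp t; linarith
  have hc2 : c ≤ 2 * t := by
    have := (abs_le.1 (Real.abs_exp_sub_one_sub_id_le (x := t) (by rwa [abs_of_nonneg ht0]))).2
    nlinarith
  -- Fix the labels `ψ` outside `G`, among them those of the images `h x`, and resample those on `G`.
  refine le_of_mul_le_mul_left ?_ hN
  rw [sum_labelling_piecewise G]
  have hinner : ∀ ψ : V → B,
      ∑ φ : V → B, Real.exp (t * (G.filter fun x =>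
        G.piecewise φ ψ x = z ∧ G.piecewise φ ψ (h x) ∈ Z).card) =
      Fintype.card (V → B) * ∏ x ∈ G, (if ψ (h x) ∈ Z then 1 + c / b else 1) := by
    intro ψ
    have h1 : ∀ φ : V → B, Real.exp (t * (G.filter fun x =>
        G.piecewise φ ψ x = z ∧ G.piecewise φ ψ (h x) ∈ Z).card) =
        ∏ x ∈ G, (if φ x = z ∧ ψ (h x) ∈ Z then Real.exp t else 1) := by
      intro φ
      rw [exp_mul_card_filter]
      refine Finset.prod_congr rfl fun x hx => ?_
      rw [Finset.piecewise_eq_of_mem _ _ _ hx, Finset.piecewise_eq_of_notMem _ _ _ (hG x hx)]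
    simp_rw [h1]
    rw [sum_prod_labelling G fun x y => if y = z ∧ ψ (h x) ∈ Z then Real.exp t else 1]
    congr 1
    refine Finset.prod_congr rfl fun x _ => ?_
    by_cases hx : ψ (h x) ∈ Z
    · simp only [hx, and_true, if_true]
      have : ∀ y : B, (if y = z then Real.exp t else 1) = 1 + if y = z then c else 0 := by
        intro y; split_ifs <;> simp [hc]
      simp_rw [this]
      rw [Finset.sum_add_distrib, Finset.sum_ite_eq']
      simp only [Finset.sum_const, Finset.card_univ, nsmul_eq_mul, mul_one, Finset.mem_univ,
        if_true, ← hbdef]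
      field_simp
    · simp only [hx, and_false, if_false, Finset.sum_const, Finset.card_univ, nsmul_eq_mul,
        mul_one, ← hbdef]
      exact div_self hb.ne'
  simp_rw [hinner, ← Finset.mul_sum]
  refine mul_le_mul_of_nonneg_left ?_ hN.le
  -- Now average over `ψ`, after grouping the factors by the image `y`.
  have houter : ∀ ψ : V → B, ∏ x ∈ G, (if ψ (h x) ∈ Z then 1 + c / b else 1) =
      ∏ y : V, (if ψ y ∈ Z then (1 + c / b) ^ (G.filter fun x => h x = y).card else 1) := by
    intro ψ
    rw [← Finset.prod_fiberwise G h]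
    refine Finset.prod_congr rfl fun y _ => ?_
    rw [Finset.prod_congr rfl (g := fun _ => if ψ y ∈ Z then 1 + c / b else 1)]
    · rw [Finset.prod_const]; split_ifs <;> simp
    · intro x hx; rw [(Finset.mem_filter.1 hx).2]
  simp_rw [houter]
  rw [sum_prod_labelling Finset.univ fun y z' =>
    if z' ∈ Z then (1 + c / b) ^ (G.filter fun x => h x = y).card else 1]
  refine mul_le_mul_of_nonneg_left ?_ hN.le
  have hfac : ∀ y : V, (∑ z' : B, if z' ∈ Z then
      (1 + c / b) ^ (G.filter fun x => h x = y).card else 1) / b ≤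
      Real.exp (2 * (Z.card / b) * (c / b) * (G.filter fun x => h x = y).card) := by
    intro y
    set k := (G.filter fun x => h x = y).card with hk
    have hkd : (k : ℝ) ≤ d := by exact_mod_cast hd y
    have hs : (c / b) * k ≤ 1 := by
      calc (c / b) * k ≤ (2 * t / b) * d := by gcongr
        _ = 2 * t * (d / b) := by ring
        _ ≤ 1 := htd
    -- linearise the power, using that its exponent times `c / b` is at most `1`
    have hpow : (1 + c / b) ^ k - 1 ≤ 2 * ((c / b) * k) := by
      have h1 : (1 + c / b) ^ k ≤ Real.exp ((c / b) * k) := by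
        rw [mul_comm, Real.exp_nat_mul]
        gcongr
        have := Real.add_one_le_exp (c / b)
        linarith
      have h0 : 0 ≤ (c / b) * k := by positivity
      have := (abs_le.1 (Real.abs_exp_sub_one_sub_id_le (x := (c / b) * k)
        (by rwa [abs_of_nonneg h0]))).2
      nlinarith
    have : ∀ z' : B, (if z' ∈ Z then (1 + c / b) ^ k else 1) =
        1 + if z' ∈ Z then (1 + c / b) ^ k - 1 else 0 := by
      intro y; split_ifs <;> ring
    simp_rw [this]
    rw [Finset.sum_add_distrib, Finset.sum_ite_mem, Finset.univ_inter]
    simp only [Finset.sum_const, Finset.card_univ, nsmul_eq_mul, mul_one, ← hbdef]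
    rw [add_div, div_self hb.ne', add_comm]
    refine le_trans ?_ (Real.add_one_le_exp _)
    gcongr
    calc Z.card * ((1 + c / b) ^ k - 1) / b = (Z.card / b) * ((1 + c / b) ^ k - 1) := by ring
      _ ≤ (Z.card / b) * (2 * ((c / b) * k)) := by gcongr
      _ = _ := by ring
  have hsum : ∑ y : V, (((G.filter fun x => h x = y).card : ℕ) : ℝ) = G.card := by
    rw [← Nat.cast_sum, ← Finset.card_eq_sum_card_fiberwise]
    simp
  calc _ ≤ ∏ y : V, Real.exp (2 * (Z.card / b) * (c / b) * (G.filter fun x => h x = y).card) := by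
        refine Finset.prod_le_prod (fun y _ => ?_) fun y _ => hfac y
        refine div_nonneg (Finset.sum_nonneg fun z' _ => ?_) hb.le
        split_ifs <;> positivity
    _ = Real.exp (2 * (Z.card / b) * (c / b) * G.card) := by
        rw [← Real.exp_sum, ← Finset.mul_sum, hsum]
    _ ≤ _ := by
        refine Real.exp_le_exp.2 ?_
        calc 2 * (Z.card / b) * (c / b) * G.card = 2 * c * ((Z.card / b) * (G.card / b)) := by ring
          _ ≤ 2 * (2 * t) * ((Z.card / b) * (G.card / b)) := by gcongr
          _ = _ := by ring

theorem card_labelling_lt_pairs_le [Nonempty B] (G : Finset V) (h : V → V)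
    (hG : ∀ x ∈ G, h x ∉ G) (z : B) (Z : Finset B) {d K : ℕ}
    (hd : ∀ y, (G.filter fun x => h x = y).card ≤ d) (hK : G.card ≤ K)
    (hbd : Fintype.card B ≤ 2 * d) :
    ((Finset.univ.filter fun φ : V → B =>
      8 * (Z.card / Fintype.card B) * (K / Fintype.card B) <
        ((G.filter fun x => φ x = z ∧ φ (h x) ∈ Z).card : ℝ)).card : ℝ) ≤
      Fintype.card (V → B) * Real.exp (-(2 * (Z.card / Fintype.card B) * (K / d))) := by
  have hb : (0 : ℝ) < Fintype.card B := by positivity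
  have hbd' : (Fintype.card B : ℝ) ≤ 2 * d := by exact_mod_cast hbd
  have hd0 : (0 : ℝ) < d := by linarith
  set b : ℝ := (Fintype.card B : ℝ) with hbdef
  set t : ℝ := b / (2 * d) with ht
  have ht0 : 0 ≤ t := by positivity
  have ht1 : t ≤ 1 := by rw [ht, div_le_one] <;> linarith
  have htd : 2 * t * (d / b) ≤ 1 := by
    rw [ht]; apply le_of_eq; field_simp
  have hK' : (G.card : ℝ) ≤ K := by exact_mod_cast hK
  have h1 := (card_mul_exp_le_sum_exp (fun φ : V → B =>
      8 * (Z.card / b) * (K / b) <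
        ((G.filter fun x => φ x = z ∧ φ (h x) ∈ Z).card : ℝ))
      (fun φ => t * (G.filter fun x => φ x = z ∧ φ (h x) ∈ Z).card)
      (t * (8 * (Z.card / b) * (K / b)))
      (fun φ hφ => mul_le_mul_of_nonneg_left hφ.le ht0)).trans
        (sum_exp_mul_card_pairs_le G h hG z Z hd ht0 ht1 htd)
  refine (card_le_of_mul_exp_le h1).trans ?_
  gcongr
  rw [← hbdef]
  have h2 : 4 * t * (Z.card / b) * (G.card / b) ≤ 4 * t * (Z.card / b) * (K / b) := by gcongr
  have h3 : t * (8 * (Z.card / b) * (K / b)) =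
      2 * (4 * t * (Z.card / b) * (K / b)) := by ring
  have h4 : 4 * t * (Z.card / b) * (K / b) = 2 * (Z.card / b) * (K / d) := by
    rw [ht]; field_simp; norm_num
  linarith

/-- The union bound. -/
theorem exists_forall_not_of_card_mul_lt {Ω I : Type*} [Fintype Ω] [Nonempty Ω] [Fintype I]
    (bad : I → Ω → Prop) [∀ i, DecidablePred (bad i)] {β : ℝ}
    (hbad : ∀ i, ((Finset.univ.filter (bad i)).card : ℝ) ≤ Fintype.card Ω * β)
    (hβ : Fintype.card I * β < 1) : ∃ ω, ∀ i, ¬ bad i ω := by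
  classical
  by_contra! hcon
  have h1 : (Finset.univ : Finset Ω) ⊆ Finset.univ.biUnion fun i => Finset.univ.filter (bad i) := by
    intro ω _
    obtain ⟨i, hi⟩ := hcon ω
    simp only [Finset.mem_biUnion, Finset.mem_filter, Finset.mem_univ, true_and]
    exact ⟨i, hi⟩
  have h2 : (Fintype.card Ω : ℝ) ≤ ∑ i, ((Finset.univ.filter (bad i)).card : ℝ) := by
    exact_mod_cast (Finset.card_le_card h1).trans Finset.card_biUnion_le
  have h3 : ∑ i, ((Finset.univ.filter (bad i)).card : ℝ) ≤
      Fintype.card I * (Fintype.card Ω * β) := by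
    refine (Finset.sum_le_sum fun i _ => hbad i).trans ?_
    simp
  have h4 : (0 : ℝ) < Fintype.card Ω := by exact_mod_cast Fintype.card_pos
  nlinarith

/-- There is a labelling for which no message has too many codewords, each large test set `A i`
contains its share of the codewords of each message, and few codewords in each `G j` are moved to a
word with label in `Z`. -/
theorem exists_labelling [Nonempty B] {M ι κ : Type*} [Fintype M] [Fintype ι] [Fintype κ]
    (e : M → B) (A : ι → Finset V) (G : κ → Finset V) (h : κ → V → V)
    (hG : ∀ j, ∀ x ∈ G j, h j x ∉ G j) (Z : Finset B) {d K : ℕ}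
    (hd : ∀ j y, ((G j).filter fun x => h j x = y).card ≤ d)
    (hbd : Fintype.card B ≤ 2 * d) (hdV : d ≤ Fintype.card V)
    {η β : ℝ} (h0 : 0 ≤ η) (h1 : η ≤ 1)
    (hβd : Real.exp (-(η ^ 2 / 4 * (d / Fintype.card B))) ≤ β)
    (hβK : Real.exp (-(2 * (Z.card / Fintype.card B) * (K / d))) ≤ β)
    (hβ : (Fintype.card M * (1 + Fintype.card ι + Fintype.card κ) : ℝ) * β < 1) :
    ∃ φ : V → B,
      (∀ m, ((Finset.univ.filter fun x => φ x = e m).card : ℝ) ≤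
        (1 + η) * (Fintype.card V / Fintype.card B)) ∧
      (∀ i m, d ≤ (A i).card → (1 - η) * ((A i).card / Fintype.card B) ≤
        (((A i).filter fun x => φ x = e m).card : ℝ)) ∧
      (∀ j m, (G j).card ≤ K →
        (((G j).filter fun x => φ x = e m ∧ φ (h j x) ∈ Z).card : ℝ) ≤
          8 * (Z.card / Fintype.card B) * (K / Fintype.card B)) := by
  classical
  have hN : (0 : ℝ) < Fintype.card (V → B) := by exact_mod_cast Fintype.card_pos
  have hβ0 : 0 ≤ β := (Real.exp_pos _).le.trans hβd
  have htail : ∀ a : ℕ, d ≤ a → Real.exp (-(η ^ 2 / 4 * (a / Fintype.card B))) ≤ β := by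
    intro a ha
    refine le_trans (Real.exp_le_exp.2 ?_) hβd
    have : (d : ℝ) ≤ a := by exact_mod_cast ha
    gcongr
  let bad : M × (Unit ⊕ ι ⊕ κ) → (V → B) → Prop := fun p φ =>
    match p with
    | (m, Sum.inl _) => (1 + η) * (Fintype.card V / Fintype.card B) <
        ((Finset.univ.filter fun x => φ x = e m).card : ℝ)
    | (m, Sum.inr (Sum.inl i)) => d ≤ (A i).card ∧
        (((A i).filter fun x => φ x = e m).card : ℝ) < (1 - η) * ((A i).card / Fintype.card B)
    | (m, Sum.inr (Sum.inr j)) => (G j).card ≤ K ∧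
        8 * (Z.card / Fintype.card B) * (K / Fintype.card B) <
          (((G j).filter fun x => φ x = e m ∧ φ (h j x) ∈ Z).card : ℝ)
  obtain ⟨φ, hφ⟩ := exists_forall_not_of_card_mul_lt bad (β := β) (by
    rintro ⟨m, _ | i | j⟩
    · refine le_trans ?_ (mul_le_mul_of_nonneg_left (htail _ hdV) hN.le)
      exact card_labelling_lt_fibre_le Finset.univ (e m) h0 h1
    · by_cases hi : d ≤ (A i).card
      · refine le_trans ?_ (mul_le_mul_of_nonneg_left (htail _ hi) hN.le)
        simpa [bad, hi] using card_labelling_fibre_lt_le (A i) (e m) h0 h1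
      · simp only [bad, hi, false_and, Finset.filter_false, Finset.card_empty, Nat.cast_zero]
        positivity
    · by_cases hj : (G j).card ≤ K
      · refine le_trans ?_ (mul_le_mul_of_nonneg_left hβK hN.le)
        simpa [bad, hj] using
          card_labelling_lt_pairs_le (G j) (h j) (hG j) (e m) Z (hd j) hj hbd
      · simp only [bad, hj, false_and, Finset.filter_false, Finset.card_empty, Nat.cast_zero]
        positivity) (by
    simpa [Fintype.card_prod, Fintype.card_sum, add_assoc] using hβ)
  refine ⟨φ, fun m => ?_, fun i m hi => ?_, fun j m hj => ?_⟩
  · exact not_lt.1 (hφ (m, Sum.inl ()))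
  · exact not_lt.1 fun hlt => hφ (m, Sum.inr (Sum.inl i)) ⟨hi, hlt⟩
  · exact not_lt.1 fun hlt => hφ (m, Sum.inr (Sum.inr j)) ⟨hj, hlt⟩

end Labelling

/-! ### The coding scheme of a labelling, and blocks of words -/

theorem sum_toReal_pmf {α : Type*} [Fintype α] (p : PMF α) : ∑ a, (p a).toReal = 1 := by
  have h := p.tsum_coe
  rw [tsum_fintype] at h
  rw [← ENNReal.toReal_sum fun a _ => p.apply_ne_top a, h, ENNReal.toReal_one]

/-- Two distributions with a common lower bound `R`, possibly negative in places, are close if the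
total of `R` is close to `1`. -/
theorem statDist_le_one_sub_sum {α : Type} [Fintype α] (p q : PMF α) (R : α → ℝ)
    (hp : ∀ a, R a ≤ (p a).toReal) (hq : ∀ a, R a ≤ (q a).toReal) :
    statDist p q ≤ 1 - ∑ a, R a := by
  have h : ∑ a, |(p a).toReal - (q a).toReal| ≤
      ∑ a, (((p a).toReal + (q a).toReal) - 2 * R a) := by
    refine Finset.sum_le_sum fun a _ => ?_
    rw [abs_le]
    constructor <;> linarith [hp a, hq a]
  rw [Finset.sum_sub_distrib, Finset.sum_add_distrib, ← Finset.mul_sum, sum_toReal_pmf,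
    sum_toReal_pmf] at h
  rw [statDist]
  linarith

open Classical in
theorem toReal_map_uniformOfFinset_apply {α β : Type*} (E : Finset α) (hE : E.Nonempty) (F : α → β)
    (o : β) : (((PMF.uniformOfFinset E hE).map F) o).toReal =
      ((E.filter fun x => F x = o).card : ℝ) / E.card := by
  rw [PMF.map_apply]
  have h : ∀ a, (if o = F a then PMF.uniformOfFinset E hE a else 0) =
      if a ∈ E.filter (fun x => F x = o) then (E.card : ℝ≥0∞)⁻¹ else 0 := by
    intro a
    by_cases h1 : F a = o <;> by_cases h2 : a ∈ E <;> simp [h1, h2, eq_comm]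
  simp_rw [h]
  rw [tsum_eq_sum (s := E.filter fun x => F x = o) (fun a ha => if_neg ha)]
  rw [Finset.sum_ite_mem, Finset.inter_self, Finset.sum_const, nsmul_eq_mul, ENNReal.toReal_mul,
    ENNReal.toReal_inv, ENNReal.toReal_natCast, ENNReal.toReal_natCast, div_eq_mul_inv]

/-- The coding scheme of a labelling `φ` of the words by a set `B` in which the messages are
embedded by `e`: a message `m` is encoded by a uniformly random word of label `e m`, and a word is
decoded by its label, to `⊥` if the label is not that of a message. -/
noncomputable def labelScheme {k n : ℕ} {B : Type*} [DecidableEq B] (e : Word k → B)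
    (he : Function.Injective e) (φ : Word n → B)
    (hne : ∀ m, (Finset.univ.filter fun x => φ x = e m).Nonempty) : CodingScheme k n where
  enc m := PMF.uniformOfFinset _ (hne m)
  dec x := Function.partialInv e (φ x)
  correct m := by
    have hsupp : ∀ x ∈ (PMF.uniformOfFinset _ (hne m)).support,
        Function.partialInv e (φ x) = some m := by
      intro x hx
      rw [PMF.mem_support_uniformOfFinset_iff, Finset.mem_filter] at hx
      rw [hx.2, Function.partialInv_left he]
    rw [PMF.apply_eq_one_iff]
    ext o
    rw [PMF.mem_support_map_iff, Set.mem_singleton_iff]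
    constructor
    · rintro ⟨x, hx, rfl⟩
      exact hsupp x hx
    · rintro rfl
      obtain ⟨x, hx⟩ := (PMF.uniformOfFinset _ (hne m)).support_nonempty
      exact ⟨x, hx, hsupp x hx⟩

section Blocks

variable {V : Type*} [DecidableEq V]

/-- The class of a word `x` of a block `X` on which the tampering function is `h`: `none` if `x` is
a fixed point of `h`, `some none` if `x` is light, that is, fewer than `d` moved words of the block
have the same image as `x`, and `some (some (h x))` otherwise. -/
def blockClass (X : Finset V) (h : V → V) (d : ℕ) (x : V) : Option (Option V) :=
  if h x = x then none
  else if (X.filter fun y => h y = h x ∧ h y ≠ y).card < d then some none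
  else some (some (h x))

/-- The words of a given class in a block. -/
def blockPart (X : Finset V) (h : V → V) (d : ℕ) (c : Option (Option V)) : Finset V :=
  X.filter fun x => blockClass X h d x = c

theorem blockClass_eq_light {X : Finset V} {h : V → V} {d : ℕ} {x : V}
    (hx : blockClass X h d x = some none) :
    h x ≠ x ∧ (X.filter fun y => h y = h x ∧ h y ≠ y).card < d := by
  unfold blockClass at hx
  split_ifs at hx with h1 h2
  · exact ⟨h1, h2⟩
  · simp at hx

theorem card_le_of_blockPart_heavy (X : Finset V) (h : V → V) (d : ℕ) (y : V)
    (hne : (blockPart X h d (some (some y))).Nonempty) :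
    d ≤ (blockPart X h d (some (some y))).card := by
  have hcl : ∀ x, h x = y → h x ≠ x → ¬ (X.filter fun y => h y = h x ∧ h y ≠ y).card < d →
      blockClass X h d x = some (some y) := by
    intro x h1 h2 h3
    rw [blockClass, if_neg h2, if_neg h3, h1]
  obtain ⟨x, hx⟩ := hne
  rw [blockPart, Finset.mem_filter] at hx
  have hx2 := hx.2
  unfold blockClass at hx2
  split_ifs at hx2 with h1 h2
  · simp at hx2
  simp only [Option.some.injEq] at hx2
  refine (not_lt.1 h2).trans (Finset.card_le_card ?_)
  intro x' hx'
  rw [Finset.mem_filter] at hx'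
  rw [blockPart, Finset.mem_filter]
  refine ⟨hx'.1, hcl x' (hx'.2.1.trans hx2) hx'.2.2 ?_⟩
  rwa [hx'.2.1]

variable [Fintype V]

/-- All but `2 * d` words of a block lie in parts with at least `d` words: only the fixed points
and the light words can form smaller parts. -/
theorem card_sub_le_sum_card_blockPart (X : Finset V) (h : V → V) (d : ℕ) :
    (X.card : ℝ) - 2 * d ≤ ∑ c, if d ≤ (blockPart X h d c).card then
      ((blockPart X h d c).card : ℝ) else 0 := by
  have h1 : (X.card : ℝ) = ∑ c, ((blockPart X h d c).card : ℝ) := by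
    rw [← Nat.cast_sum]
    simp only [blockPart]
    rw [← Finset.card_eq_sum_card_fiberwise]
    simp
  have hs : ∀ c, ((blockPart X h d c).card : ℝ) ≤
      (if d ≤ (blockPart X h d c).card then ((blockPart X h d c).card : ℝ) else 0) + d := by
    intro c
    split_ifs with hc
    · simp
    · have : ((blockPart X h d c).card : ℝ) ≤ d := by exact_mod_cast (not_le.1 hc).le
      linarith
  have hy : ∀ y : V, ((blockPart X h d (some (some y))).card : ℝ) =
      if d ≤ (blockPart X h d (some (some y))).card then
        ((blockPart X h d (some (some y))).card : ℝ) else 0 := by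
    intro y
    split_ifs with hc
    · rfl
    · rw [Nat.cast_eq_zero, Finset.card_eq_zero]
      by_contra hne
      exact hc (card_le_of_blockPart_heavy X h d y (Finset.nonempty_iff_ne_empty.2 hne))
  rw [h1]
  simp only [Fintype.sum_option]
  have := hs none
  have := hs (some none)
  rw [Finset.sum_congr rfl fun y _ => hy y]
  linarith

variable {M : Type*} [DecidableEq M]

/-- The outcome of the tampering experiment on a word of a given class, if the light words that are
moved to codewords are neglected. -/
def classOutcome (dec : V → Option M) : Option (Option V) → Option (Option M)
  | none => none
  | some none => some none
  | some (some y) => some (dec y)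

/-- Replacing the actual outcome by `classOutcome` changes it only on light words that are moved to
codewords, and there the replaced outcome is `⊥`. -/
theorem card_classOutcome_le (X : Finset V) (h : V → V) (d : ℕ) (dec : V → Option M)
    (E : V → Prop) [DecidablePred E] {τ : ℝ}
    (hτ : (((blockPart X h d (some none)).filter fun x => E x ∧ dec (h x) ≠ none).card : ℝ) ≤ τ)
    (o : Option (Option M)) :
    (∑ c, if classOutcome dec c = o then (((blockPart X h d c).filter E).card : ℝ) else 0) -
      (if o = some none then τ else 0) ≤
      ((X.filter fun x => E x ∧ (if h x = x then none else some (dec (h x))) = o).card : ℝ) := by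
  have h1 : (∑ c, if classOutcome dec c = o then
      (((blockPart X h d c).filter E).card : ℝ) else 0) =
      ((X.filter fun x => E x ∧ classOutcome dec (blockClass X h d x) = o).card : ℝ) := by
    rw [Finset.card_eq_sum_card_fiberwise (f := blockClass X h d) (t := Finset.univ) (by simp)]
    push_cast
    refine Finset.sum_congr rfl fun c _ => ?_
    split_ifs with hc
    · congr 2
      ext x
      simp only [blockPart, Finset.mem_filter]
      constructor
      · rintro ⟨⟨hx, rfl⟩, hE⟩; exact ⟨⟨hx, hE, hc⟩, rfl⟩
      · rintro ⟨⟨hx, hE, _⟩, hc⟩; exact ⟨⟨hx, hc⟩, hE⟩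
    · symm
      rw [Nat.cast_eq_zero, Finset.card_eq_zero, Finset.filter_eq_empty_iff]
      rintro x hx rfl
      exact hc (Finset.mem_filter.1 hx).2.2
  have h2 : X.filter (fun x => E x ∧ classOutcome dec (blockClass X h d x) = o) ⊆
      X.filter (fun x => E x ∧ (if h x = x then none else some (dec (h x))) = o) ∪
      (if o = some none then
        ((blockPart X h d (some none)).filter fun x => E x ∧ dec (h x) ≠ none) else ∅) := by
    intro x hx
    rw [Finset.mem_filter] at hx
    obtain ⟨hxX, hE, ho⟩ := hx
    rw [Finset.mem_union, Finset.mem_filter]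
    by_cases hl : blockClass X h d x = some none
    · have hmoved := (blockClass_eq_light hl).1
      rw [hl] at ho
      simp only [classOutcome] at ho
      by_cases hdec : dec (h x) = none
      · left
        exact ⟨hxX, hE, by rw [if_neg hmoved, hdec, ho]⟩
      · right
        rw [if_pos ho.symm, blockPart, Finset.mem_filter, Finset.mem_filter]
        exact ⟨⟨hxX, hl⟩, hE, hdec⟩
    · left
      refine ⟨hxX, hE, ?_⟩
      rw [← ho]
      unfold blockClass at hl ⊢
      split_ifs at hl ⊢ <;> first | exact absurd rfl hl | simp [classOutcome]
  have h3 := (Finset.card_le_card h2).trans (Finset.card_union_le _ _)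
  rw [h1]
  have h4 : ((X.filter (fun x => E x ∧ classOutcome dec (blockClass X h d x) = o)).card : ℝ) ≤
      ((X.filter (fun x => E x ∧ (if h x = x then none else some (dec (h x))) = o)).card : ℝ) +
      (((if o = some none then
        ((blockPart X h d (some none)).filter fun x => E x ∧ dec (h x) ≠ none) else ∅) :
          Finset V).card : ℝ) := by exact_mod_cast h3
  split_ifs at h4 ⊢
  · linarith
  · rw [Finset.card_empty, Nat.cast_zero] at h4
    linarith

end Blocks

/-! ### Security of the scheme of a well-distributed labelling -/

section Blocks

variable {V : Type*} [DecidableEq V] [Fintype V] {M : Type*} [DecidableEq M]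

/-- A lower bound for the number of codewords of any one message that lie in the block `X` and
produce the outcome `o`, in a code where each part with at least `d` words contains its share of
the codewords up to the factor `1 - η`, and where at most `τ` codewords are light and moved to a
codeword.  It does not depend on the message. -/
noncomputable def blockBound (X : Finset V) (h : V → V) (d : ℕ) (dec : V → Option M) (b η τ : ℝ)
    (o : Option (Option M)) : ℝ :=
  (∑ c, if classOutcome dec c = o then
    (if d ≤ (blockPart X h d c).card then (1 - η) * ((blockPart X h d c).card / b) else 0) else 0) -
  (if o = some none then τ else 0)

theorem blockBound_le (X : Finset V) (h : V → V) (d : ℕ) (dec : V → Option M) {b η τ : ℝ}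
    (E : V → Prop) [DecidablePred E]
    (hE : ∀ c, d ≤ (blockPart X h d c).card →
      (1 - η) * ((blockPart X h d c).card / b) ≤ (((blockPart X h d c).filter E).card : ℝ))
    (hτ : (((blockPart X h d (some none)).filter fun x => E x ∧ dec (h x) ≠ none).card : ℝ) ≤ τ)
    (o : Option (Option M)) :
    blockBound X h d dec b η τ o ≤
      ((X.filter fun x => E x ∧ (if h x = x then none else some (dec (h x))) = o).card : ℝ) := by
  refine le_trans ?_ (card_classOutcome_le X h d dec E hτ o)
  unfold blockBound
  refine sub_le_sub_right (Finset.sum_le_sum fun c _ => ?_) _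
  split_ifs with h1 h2
  · exact hE c h2
  · positivity
  · rfl

/-- The bounds `blockBound` exhaust the expected number of codewords in the block, up to `2 * d`
words, the factor `1 - η`, and the loss `τ`. -/
theorem le_sum_blockBound [Fintype M] (X : Finset V) (h : V → V) (d : ℕ) (dec : V → Option M)
    {b η τ : ℝ} (hb : 0 < b) (hη : η ≤ 1) :
    (1 - η) * ((X.card - 2 * d) / b) - τ ≤ ∑ o, blockBound X h d dec b η τ o := by
  unfold blockBound
  rw [Finset.sum_sub_distrib, Finset.sum_ite_eq' Finset.univ (some none), Finset.sum_comm,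
    if_pos (Finset.mem_univ _)]
  refine sub_le_sub_right ?_ _
  simp_rw [Finset.sum_ite_eq, if_pos (Finset.mem_univ _)]
  have h1 := card_sub_le_sum_card_blockPart X h d
  have h2 : (∑ c, if d ≤ (blockPart X h d c).card then
      (1 - η) * ((blockPart X h d c).card / b) else 0) = (1 - η) * ((∑ c,
      if d ≤ (blockPart X h d c).card then ((blockPart X h d c).card : ℝ) else 0) / b) := by
    rw [Finset.sum_div, Finset.mul_sum]
    refine Finset.sum_congr rfl fun c _ => ?_
    split_ifs <;> simp
  rw [h2]
  have : 0 ≤ 1 - η := by linarith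
  gcongr

end Blocks

/-- Security of the scheme of a labelling against a tampering function that reads `π x` and then
acts by `h (π x)`, if the codewords of all messages are well distributed in the blocks `π x = a`. -/
theorem statDist_strongNM_labelScheme_le {k n : ℕ} {B : Type*} [DecidableEq B] [Fintype B]
    [Nonempty B]
    {e : Word k → B} (he : Function.Injective e) (φ : Word n → B)
    (hne : ∀ m, (Finset.univ.filter fun x => φ x = e m).Nonempty)
    {α : Type*} [Fintype α] [DecidableEq α] (π : Word n → α) (h : α → Word n → Word n)
    {K d : ℕ} (hK : ∀ a, (Finset.univ.filter fun x => π x = a).card = K)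
    {η τ : ℝ} (hη0 : 0 ≤ η) (hη1 : η ≤ 1)
    (hupper : ∀ m, ((Finset.univ.filter fun x => φ x = e m).card : ℝ) ≤
      (1 + η) * (Fintype.card (Word n) / Fintype.card B))
    (hlower : ∀ m a c, d ≤ (blockPart (Finset.univ.filter fun x => π x = a) (h a) d c).card →
      (1 - η) * ((blockPart (Finset.univ.filter fun x => π x = a) (h a) d c).card /
        Fintype.card B) ≤ (((blockPart (Finset.univ.filter fun x => π x = a) (h a) d c).filter
          fun x => φ x = e m).card : ℝ))
    (hlight : ∀ m a, (((blockPart (Finset.univ.filter fun x => π x = a) (h a) d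
      (some none)).filter fun x => φ x = e m ∧ φ (h a x) ∈ Set.range e).card : ℝ) ≤ τ)
    (m₀ m₁ : Word k) :
    statDist ((labelScheme e he φ hne).strongNM (fun x => h (π x) x) m₀)
      ((labelScheme e he φ hne).strongNM (fun x => h (π x) x) m₁) ≤
      1 - (Fintype.card α * ((1 - η) * ((K - 2 * d) / Fintype.card B) - τ)) /
        ((1 + η) * (Fintype.card (Word n) / Fintype.card B)) := by
  classical
  have hb : (0 : ℝ) < Fintype.card B := by positivity
  have hU : (0 : ℝ) < (1 + η) * (Fintype.card (Word n) / Fintype.card B) := by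
    have : (0 : ℝ) < Fintype.card (Word n) := by exact_mod_cast Fintype.card_pos
    positivity
  set dec : Word n → Option (Word k) := fun x => Function.partialInv e (φ x) with hdec
  have hdec_ne : ∀ x, dec x ≠ none ↔ φ x ∈ Set.range e := by
    intro x
    rw [Option.ne_none_iff_exists']
    constructor
    · rintro ⟨m, hm⟩
      exact ⟨m, (he.isPartialInv m (φ x)).1 hm⟩
    · rintro ⟨m, hm⟩
      exact ⟨m, by rw [hdec]; simp only [← hm]; exact Function.partialInv_left he m⟩
  set R : Option (Option (Word k)) → ℝ := fun o => ∑ a,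
    blockBound (Finset.univ.filter fun x => π x = a) (h a) d dec (Fintype.card B) η τ o with hR
  have hcount : ∀ m o, R o ≤ (((Finset.univ.filter fun x => φ x = e m).filter fun x =>
      (if h (π x) x = x then none else some (dec (h (π x) x))) = o).card : ℝ) := by
    intro m o
    rw [Finset.card_eq_sum_card_fiberwise (f := π) (t := Finset.univ) (by simp)]
    push_cast
    refine Finset.sum_le_sum fun a _ => ?_
    refine (blockBound_le _ (h a) d dec (fun x => φ x = e m) (hlower m a) ?_ o).trans
      (le_of_eq ?_)
    · simp_rw [hdec_ne]
      exact hlight m a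
    · congr 2
      ext x
      simp only [Finset.mem_filter, Finset.mem_univ, true_and]
      constructor
      · rintro ⟨rfl, h1, h2⟩; exact ⟨⟨h1, h2⟩, rfl⟩
      · rintro ⟨⟨h1, h2⟩, rfl⟩; exact ⟨rfl, h1, h2⟩
  -- `R (some none)` can be negative, and then dividing it by an upper bound of the number of codewords
  -- would not give a lower bound; hence the maximum.
  have hprob : ∀ m o, max (R o) 0 / ((1 + η) * (Fintype.card (Word n) / Fintype.card B)) ≤
      ((labelScheme e he φ hne).strongNM (fun x => h (π x) x) m o).toReal := by
    intro m o
    have hcard : (0 : ℝ) < (Finset.univ.filter fun x => φ x = e m).card := by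
      exact_mod_cast Finset.card_pos.2 (hne m)
    have := toReal_map_uniformOfFinset_apply _ (hne m)
      (fun x => if h (π x) x = x then none else some (dec (h (π x) x))) o
    refine le_trans ?_ (le_of_eq this.symm)
    refine div_le_div₀ (Nat.cast_nonneg _) (max_le ?_ (Nat.cast_nonneg _)) hcard (hupper m)
    exact (hcount m o).trans (le_of_eq (by congr))
  refine (statDist_le_one_sub_sum _ _ _ (hprob m₀) (hprob m₁)).trans ?_
  rw [← Finset.sum_div]
  refine sub_le_sub_left ?_ _
  refine div_le_div_of_nonneg_right ?_ hU.le
  calc (Fintype.card α : ℝ) * ((1 - η) * ((K - 2 * d) / Fintype.card B) - τ)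
      = ∑ a : α, ((1 - η) * ((((Finset.univ.filter fun x => π x = a).card : ℕ) - 2 * d) /
          Fintype.card B) - τ) := by simp [hK, mul_sub]
    _ ≤ ∑ a : α, ∑ o, blockBound (Finset.univ.filter fun x => π x = a) (h a) d dec
          (Fintype.card B) η τ o := Finset.sum_le_sum fun a _ => le_sum_blockBound _ _ _ _ hb hη1
    _ = ∑ o, R o := Finset.sum_comm
    _ ≤ ∑ o, max (R o) 0 := Finset.sum_le_sum fun o _ => le_max_left _ _

/-- The words that agree with `c` on `S`. -/
def cube {n : ℕ} (S : Finset (Fin n)) (c : Word n) : Finset (Word n) :=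
  Finset.univ.filter fun x => ∀ i ∈ S, x i = c i

theorem card_cube {n : ℕ} (S : Finset (Fin n)) (c : Word n) :
    (cube S c).card = 2 ^ (n - S.card) := by
  have h : cube S c = Fintype.piFinset fun i => if i ∈ S then {c i} else Finset.univ := by
    ext x
    simp only [cube, Finset.mem_filter, Finset.mem_univ, true_and, Fintype.mem_piFinset]
    refine forall_congr' fun i => ?_
    by_cases hi : i ∈ S <;> simp [hi]
  rw [h, Fintype.card_piFinset]
  have : ∀ i, (if i ∈ S then ({c i} : Finset Bool) else Finset.univ).card =
      if i ∈ S then 1 else 2 := by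
    intro i; split_ifs <;> simp
  simp_rw [this]
  rw [Finset.prod_ite, Finset.prod_const_one, one_mul, Finset.prod_const, Finset.filter_not,
    Finset.card_sdiff]
  simp

/-- The bits read by the tampering function. -/
def restrict {n : ℕ} (S : Finset (Fin n)) (x : Word n) : {i // i ∈ S} → Bool := fun j => x j.1

theorem filter_restrict_eq {n : ℕ} (S : Finset (Fin n)) (a : {i // i ∈ S} → Bool) :
    (Finset.univ.filter fun x => restrict S x = a) =
      cube S fun i => if h : i ∈ S then a ⟨i, h⟩ else false := by
  ext x
  simp only [cube, Finset.mem_filter, Finset.mem_univ, true_and, funext_iff, restrict,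
    Subtype.forall]
  refine forall_congr' fun i => forall_congr' fun hi => ?_
  rw [dif_pos hi]

/-- The function that acts on the `i`-th bit by `true ↦ v i` and `false ↦ w i`. -/
def bitwise {n : ℕ} (v w : Word n) (x : Word n) : Word n := fun i => if x i then v i else w i

theorem exists_tamper_eq_bitwise {n : ℕ} (Sr Sw : Finset (Fin n))
    (g : ({i // i ∈ Sr} → Bool) → ({i // i ∈ Sw} → BitFn)) :
    ∃ v w : ({i // i ∈ Sr} → Bool) → Word n,
      tamper Sr Sw g = fun x => bitwise (v (restrict Sr x)) (w (restrict Sr x)) x := by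
  refine ⟨fun a i => if h : i ∈ Sw then (g a ⟨i, h⟩).apply true else true,
    fun a i => if h : i ∈ Sw then (g a ⟨i, h⟩).apply false else false, ?_⟩
  funext x i
  unfold tamper bitwise
  cases hx : x i <;> by_cases hi : i ∈ Sw <;> simp [hi] <;> rfl

/-! ### Existence of secure schemes -/

section Existence

variable {n : ℕ}

/-- The light words of a block whose `i`-th bit is changed from `β`.  The tampering function takes
this set to the words whose `i`-th bit is not `β`, so it does not meet its image. -/
def lightPart (S : Finset (Fin n)) (c v w : Word n) (d : ℕ) (i : Fin n) (β : Bool) :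
    Finset (Word n) :=
  (blockPart (cube S c) (bitwise v w) d (some none)).filter
    fun x => x i = β ∧ bitwise v w x i ≠ β

theorem bitwise_notMem_lightPart {S : Finset (Fin n)} {c v w : Word n} {d : ℕ} {i : Fin n}
    {β : Bool} {x : Word n} (hx : x ∈ lightPart S c v w d i β) :
    bitwise v w x ∉ lightPart S c v w d i β := fun h =>
  (Finset.mem_filter.1 hx).2.2 (Finset.mem_filter.1 h).2.1

theorem card_lightPart_le (S : Finset (Fin n)) (c v w : Word n) (d : ℕ) (i : Fin n) (β : Bool) :
    (lightPart S c v w d i β).card ≤ 2 ^ (n - S.card) := by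
  rw [← card_cube S c]
  exact Finset.card_le_card ((Finset.filter_subset _ _).trans (Finset.filter_subset _ _))

theorem card_lightPart_fibre_le (S : Finset (Fin n)) (c v w : Word n) (d : ℕ) (i : Fin n)
    (β : Bool) (y : Word n) :
    ((lightPart S c v w d i β).filter fun x => bitwise v w x = y).card ≤ d := by
  rcases Finset.eq_empty_or_nonempty
    ((lightPart S c v w d i β).filter fun x => bitwise v w x = y) with h | ⟨x, hx⟩
  · simp [h]
  have hlight : ∀ x ∈ lightPart S c v w d i β, x ∈ cube S c ∧ bitwise v w x ≠ x ∧
      ((cube S c).filter fun y => bitwise v w y = bitwise v w x ∧ bitwise v w y ≠ y).card < d := by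
    intro x hx
    have h1 := Finset.mem_filter.1 (Finset.mem_filter.1 hx).1
    exact ⟨h1.1, blockClass_eq_light h1.2⟩
  rw [Finset.mem_filter] at hx
  refine le_trans (Finset.card_le_card ?_) (hlight x hx.1).2.2.le
  intro x' hx'
  rw [Finset.mem_filter] at hx' ⊢
  exact ⟨(hlight x' hx'.1).1, hx'.2.trans hx.2.symm, (hlight x' hx'.1).2.1⟩

/-- Each light word has some bit `i` changed from some value `β`, so the sets `lightPart` cover the
light words. -/
theorem card_light_filter_le (S : Finset (Fin n)) (c v w : Word n) (d : ℕ) (P : Word n → Prop)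
    [DecidablePred P] {θ : ℝ}
    (hθ : ∀ i β, (((lightPart S c v w d i β).filter P).card : ℝ) ≤ θ) :
    (((blockPart (cube S c) (bitwise v w) d (some none)).filter P).card : ℝ) ≤ 2 * n * θ := by
  have hsub : (blockPart (cube S c) (bitwise v w) d (some none)).filter P ⊆
      Finset.univ.biUnion fun p : Fin n × Bool => (lightPart S c v w d p.1 p.2).filter P := by
    intro x hx
    rw [Finset.mem_filter] at hx
    have hmoved := (blockClass_eq_light (Finset.mem_filter.1 hx.1).2).1
    obtain ⟨i, hi⟩ := Function.ne_iff.1 hmoved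
    simp only [Finset.mem_biUnion, Finset.mem_univ, true_and, Prod.exists]
    exact ⟨i, x i, Finset.mem_filter.2 ⟨Finset.mem_filter.2 ⟨hx.1, rfl, hi⟩, hx.2⟩⟩
  calc _ ≤ ∑ p : Fin n × Bool, (((lightPart S c v w d p.1 p.2).filter P).card : ℝ) := by
        exact_mod_cast (Finset.card_le_card hsub).trans Finset.card_biUnion_le
    _ ≤ ∑ p : Fin n × Bool, θ := Finset.sum_le_sum fun p _ => hθ p.1 p.2
    _ = 2 * n * θ := by 
        rw [Finset.sum_const, Finset.card_univ, Fintype.card_prod, Fintype.card_fin,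
          Fintype.card_bool, nsmul_eq_mul]
        push_cast
        ring

/-- The number of events in the union bound: there are `2 ^ (4 * n)` pairs of a block and a bitwise
function (given by a set, a centre, and two words), each with `2 ^ n + 2` parts and `2 * n` sets of
light words, and these for every message. -/
theorem card_labelling_events_le {k n : ℕ} (hkn : (2 : ℝ) ^ k ≤ 2 ^ n) :
    (2 : ℝ) ^ k * (1 + 2 ^ n * (2 ^ n * (2 ^ n * 2 ^ n)) * (2 ^ n + 1 + 1) +
      2 ^ n * (2 ^ n * (2 ^ n * 2 ^ n)) * (n * 2)) ≤ 2 ^ (6 * n + 3) := by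
  have hnn : (n : ℝ) ≤ 2 ^ n := by exact_mod_cast Nat.lt_two_pow_self.le
  have h8 : (2 : ℝ) ^ (6 * n + 3) = 8 * (2 ^ n) ^ 6 := by ring
  rw [h8]
  generalize (2 : ℝ) ^ n = N at *
  have hN1 : (1 : ℝ) ≤ N := (one_le_pow₀ (by norm_num)).trans hkn
  have hN5 : (1 : ℝ) ≤ N ^ 5 := one_le_pow₀ hN1
  have hN4 : 0 ≤ N ^ 4 := by positivity
  have hin : 1 + N * (N * (N * N)) * (N + 1 + 1) + N * (N * (N * N)) * (n * 2) ≤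
      N ^ 5 + N ^ 4 * (N + N + N) + N ^ 4 * (N * 2) := by
    have h1 : N ^ 4 * (N + 1 + 1) ≤ N ^ 4 * (N + N + N) :=
      mul_le_mul_of_nonneg_left (by linarith) hN4
    have h2 : N ^ 4 * (n * 2) ≤ N ^ 4 * (N * 2) :=
      mul_le_mul_of_nonneg_left (by linarith) hN4
    have h3 : N * (N * (N * N)) = N ^ 4 := by ring
    rw [h3]
    linarith
  calc _ ≤ N * (N ^ 5 + N ^ 4 * (N + N + N) + N ^ 4 * (N * 2)) := by gcongr
    _ = 6 * N ^ 6 := by ring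
    _ ≤ 8 * N ^ 6 := by gcongr; norm_num

/-- The security error for `U = 2 ^ u`, `A = 2 ^ k` and `R = 2 ^ r` in
`statDist_strongNM_labelScheme_le`. -/
theorem one_sub_share_le {U q A R : ℝ} (hU : 0 < U) (hqU : q = U⁻¹) (hq1 : q ≤ 1) (hA : 0 < A)
    (hR : 0 < R) (n : ℕ) :
    1 - (R * ((1 - q) * ((A * U ^ 8 - 2 * (A * U ^ 5)) / (A * U)) -
        2 * n * (8 * q * (A * U ^ 8 / (A * U))))) / ((1 + q) * (R * (A * U ^ 8) / (A * U))) ≤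
      (16 * n + 4) * q := by
  have hq0 : 0 < q := by rw [hqU]; positivity
  have hquot : (R * ((1 - q) * ((A * U ^ 8 - 2 * (A * U ^ 5)) / (A * U)) -
      2 * n * (8 * q * (A * U ^ 8 / (A * U))))) / ((1 + q) * (R * (A * U ^ 8) / (A * U))) =
      ((1 - q) * (1 - 2 * q ^ 3) - 16 * n * q) / (1 + q) := by
    have h1 : 1 + q ≠ 0 := by positivity
    rw [div_eq_div_iff (by positivity) h1, hqU]
    field_simp
    ring
  rw [hquot, sub_le_iff_le_add, ← sub_le_iff_le_add', le_div_iff₀ (by linarith)]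
  have hn0 : (0 : ℝ) ≤ n := Nat.cast_nonneg _
  have hq3 : q ^ 3 ≤ q := pow_le_of_le_one hq0.le hq1 (by norm_num)
  have h1 : 0 ≤ n * (q * q) := by positivity
  have h2 : 0 < q ^ 4 := by positivity
  have h3 : 0 < q * q := by positivity
  nlinarith

/-- Existence of a secure scheme whose message length falls short of the number of unread bits by
`8 * u`.  With `q = 2 ^ (-u)`: the accuracy is `η = q`, a random label is that of a message with
probability `q`, a part of `d` words has `2 ^ (4 * u)` expected codewords per message, so that its
tail exponent is `η ^ 2 * 2 ^ (4 * u) / 4 = 4 ^ u / 4`, and a block has `2 ^ (7 * u)`. -/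
theorem exists_codingScheme {k u r : ℕ} (hn : r + k + 8 * u = n)
    (hu : (2 : ℝ) ^ (6 * n + 3) * Real.exp (-(4 ^ u / 4)) < 1) (hu1 : 1 ≤ u) :
    ∃ C : CodingScheme k n, ∀ ρr ρw : ℝ, ⌊ρr * n⌋₊ = r →
      C.IsStronglyNonMalleable (bitTamperingWithLeakage n ρr ρw) ((16 * n + 4) * (1 / 2) ^ u) := by
  obtain ⟨e⟩ : Nonempty (Word k ↪ Word (k + u)) := by
    apply Function.Embedding.nonempty_of_card_le
    simp only [Fintype.card_fun, Fintype.card_fin, Fintype.card_bool]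
    exact Nat.pow_le_pow_right (by norm_num) (by omega)
  have hcardB : (Fintype.card (Word (k + u)) : ℝ) = 2 ^ k * 2 ^ u := by simp [pow_add]
  have hcardV : (Fintype.card (Word n) : ℝ) = 2 ^ n := by simp
  have hu0 : (0 : ℝ) < 2 ^ u := by positivity
  set q : ℝ := (1 / 2) ^ u with hq
  have hq2 : q * 2 ^ u = 1 := by rw [hq, ← mul_pow]; norm_num
  have hqinv : q = (2 ^ u)⁻¹ := eq_inv_of_mul_eq_one_left hq2
  have hq0 : 0 < q := by positivity
  have hq1 : q ≤ 1 := pow_le_one₀ (by norm_num) (by norm_num)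
  set Z : Finset (Word (k + u)) := Finset.univ.map e with hZ
  have hZcard : (Z.card : ℝ) / Fintype.card (Word (k + u)) = q := by
    rw [hZ, Finset.card_map, hcardB, hqinv]
    simp only [Finset.card_univ, Fintype.card_fun, Fintype.card_fin, Fintype.card_bool]
    push_cast
    field_simp
  set d : ℕ := 2 ^ (k + 5 * u) with hd
  set K : ℕ := 2 ^ (k + 8 * u) with hKdef
  have hdR : (d : ℝ) = 2 ^ k * (2 ^ u) ^ 5 := by rw [hd]; push_cast; ring
  have hKR : (K : ℝ) = 2 ^ k * (2 ^ u) ^ 8 := by rw [hKdef]; push_cast; ring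
  have h4 : (4 : ℝ) ^ u = (2 ^ u) ^ 2 := by rw [← pow_mul, mul_comm, pow_mul]; norm_num
  have hkn : (2 : ℝ) ^ k ≤ 2 ^ n := pow_le_pow_right₀ (by norm_num) (by omega)
  have hdn : d ≤ 2 ^ n := Nat.pow_le_pow_right (by norm_num) (by omega)
  obtain ⟨φ, hφ1, hφ2, hφ3⟩ := exists_labelling (V := Word n) (B := Word (k + u))
    (ι := (Finset (Fin n) × Word n × Word n × Word n) × Option (Option (Word n)))
    (κ := (Finset (Fin n) × Word n × Word n × Word n) × Fin n × Bool) e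
    (fun p => blockPart (cube p.1.1 p.1.2.1) (bitwise p.1.2.2.1 p.1.2.2.2) d p.2)
    (fun p => lightPart p.1.1 p.1.2.1 p.1.2.2.1 p.1.2.2.2 d p.2.1 p.2.2)
    (fun p => bitwise p.1.2.2.1 p.1.2.2.2)
    (fun p x hx => bitwise_notMem_lightPart hx) Z (d := d) (K := K)
    (fun p y => card_lightPart_fibre_le _ _ _ _ _ _ _ _)
    (by
      have : 2 ^ (k + u) ≤ 2 ^ (k + 5 * u) := Nat.pow_le_pow_right (by norm_num) (by omega)
      simp only [Fintype.card_fun, Fintype.card_fin, Fintype.card_bool, hd]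
      omega)
    (by simpa using hdn) hq0.le hq1 (β := Real.exp (-(4 ^ u / 4)))
    (Real.exp_le_exp.2 (neg_le_neg (le_of_eq (by
      rw [hcardB, hdR, h4, hqinv]; field_simp))))
    (Real.exp_le_exp.2 (neg_le_neg (by
      rw [hZcard, hdR, hKR, h4, hqinv]
      have : 2 * (2 ^ u : ℝ)⁻¹ * (2 ^ k * (2 ^ u) ^ 8 / (2 ^ k * (2 ^ u) ^ 5)) =
        2 * (2 ^ u) ^ 2 := by field_simp
      rw [this]
      have : (0 : ℝ) ≤ (2 ^ u) ^ 2 := by positivity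
      linarith)))
    (by
      refine lt_of_le_of_lt ?_ hu
      refine mul_le_mul_of_nonneg_right ?_ (Real.exp_pos _).le
      simp only [Fintype.card_prod, Fintype.card_finset, Fintype.card_fun, Fintype.card_fin,
        Fintype.card_bool, Fintype.card_option]
      push_cast
      exact card_labelling_events_le hkn)
  -- every message has a codeword: the identity on all words is one of the parts
  have hne : ∀ m, (Finset.univ.filter fun x => φ x = e m).Nonempty := by
    intro m
    have hid : bitwise (fun _ : Fin n => true) (fun _ => false) = id := by
      funext x i
      simp [bitwise]
    have hpart : blockPart (cube (∅ : Finset (Fin n)) fun _ => false)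
        (bitwise (fun _ => true) fun _ => false) d none = Finset.univ := by
      ext x
      simp [blockPart, cube, blockClass, hid]
    have h1 := hφ2 ((∅, (fun _ => false), (fun _ => true), fun _ => false), none) m
    simp only [hpart] at h1
    have h2 := h1 (by simpa using hdn)
    rw [Finset.card_univ, hcardV, hcardB] at h2
    have hq' : q < 1 := pow_lt_one₀ (by norm_num) (by norm_num) (by omega)
    have h3 : (0 : ℝ) < (1 - q) * (2 ^ n / (2 ^ k * 2 ^ u)) := by
      have : 0 < 1 - q := by linarith
      positivity
    exact Finset.card_pos.1 (by exact_mod_cast h3.trans_le h2)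
  refine ⟨labelScheme e e.injective φ hne, ?_⟩
  rintro ρr ρw hr m₀ m₁ f ⟨Sr, Sw, hSr, -, g, rfl⟩
  rw [hr] at hSr
  have hSrn : n - Sr.card = k + 8 * u := by omega
  obtain ⟨v, w, hvw⟩ := exists_tamper_eq_bitwise Sr Sw g
  rw [hvw]
  refine (statDist_strongNM_labelScheme_le e.injective φ hne (restrict Sr)
    (fun a => bitwise (v a) (w a)) (K := K) (d := d) (η := q)
    (τ := 2 * n * (8 * q * (K / Fintype.card (Word (k + u))))) ?_ hq0.le hq1 hφ1 ?_ ?_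
    m₀ m₁).trans ?_
  · intro a
    rw [filter_restrict_eq, card_cube, hSrn]
  · intro m a c
    simp only [filter_restrict_eq]
    exact hφ2 ((Sr, _, _, _), c) m
  · intro m a
    simp only [filter_restrict_eq]
    refine card_light_filter_le _ _ _ _ _ _ fun i β => ?_
    have h1 := hφ3 ((Sr, (fun i => if h : i ∈ Sr then a ⟨i, h⟩ else false),
      v a, w a), i, β) m
      ((card_lightPart_le _ _ _ _ _ _ _).trans (by rw [hSrn]))
    rw [hZcard] at h1
    refine le_trans (le_of_eq ?_) h1
    congr 2
    ext x
    simp [hZ]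
  · have hα : (Fintype.card ({i // i ∈ Sr} → Bool) : ℝ) = 2 ^ r := by
      simp [hSr]
    have hpow : (2 : ℝ) ^ n = 2 ^ r * (2 ^ k * (2 ^ u) ^ 8) := by
      rw [← hn]; ring
    rw [hα, hcardV, hcardB, hdR, hKR, hpow]
    exact one_sub_share_le hu0 hqinv hq1 (by positivity) (by positivity) n

end Existence

/-! ### Statistical distance, shortening, and the bound on the message length -/

theorem toReal_map_apply {α β : Type*} [Fintype α] [DecidableEq β] (p : PMF α) (F : α → β) (b : β) :
    ((p.map F) b).toReal = ∑ a, if F a = b then (p a).toReal else 0 := by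
  rw [PMF.map_apply, tsum_fintype, ENNReal.toReal_sum]
  · refine Finset.sum_congr rfl fun a _ => ?_
    by_cases h : F a = b
    · simp [h]
    · simp [h, Ne.symm h]
  · intro a _
    split_ifs
    · exact p.apply_ne_top a
    · exact ENNReal.zero_ne_top

/-- The data processing inequality. -/
theorem statDist_map_le {α β : Type} [Fintype α] [Fintype β] (p q : PMF α) (F : α → β) :
    statDist (p.map F) (q.map F) ≤ statDist p q := by
  classical
  unfold statDist
  refine mul_le_mul_of_nonneg_left ?_ (by norm_num)
  calc ∑ b, |((p.map F) b).toReal - ((q.map F) b).toReal|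
      ≤ ∑ b, ∑ a, (if F a = b then |(p a).toReal - (q a).toReal| else 0) := by
        refine Finset.sum_le_sum fun b _ => ?_
        rw [toReal_map_apply, toReal_map_apply, ← Finset.sum_sub_distrib]
        refine (Finset.abs_sum_le_sum_abs _ _).trans (le_of_eq ?_)
        refine Finset.sum_congr rfl fun a _ => ?_
        split_ifs <;> simp
    _ = ∑ a, |(p a).toReal - (q a).toReal| := by
        rw [Finset.sum_comm]
        simp

theorem sub_le_statDist {α : Type} [Fintype α] (p q : PMF α) (a : α) :
    (p a).toReal - (q a).toReal ≤ statDist q p := by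
  classical
  have hp := sum_toReal_pmf p
  have hq := sum_toReal_pmf q
  rw [← Finset.add_sum_erase _ _ (Finset.mem_univ a)] at hp hq
  unfold statDist
  rw [← Finset.add_sum_erase _ _ (Finset.mem_univ a)]
  have h1 := le_abs_self (((p a).toReal - (q a).toReal))
  rw [abs_sub_comm] at h1
  have h2 : ∑ x ∈ Finset.univ.erase a, ((q x).toReal - (p x).toReal) ≤
      ∑ x ∈ Finset.univ.erase a, |(q x).toReal - (p x).toReal| :=
    Finset.sum_le_sum fun x _ => le_abs_self _
  rw [Finset.sum_sub_distrib] at h2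
  linarith

namespace CodingScheme

variable {k n : ℕ} (C : CodingScheme k n)

theorem dec_of_mem_support {m : Word k} {x : Word n} (hx : x ∈ (C.enc m).support) :
    C.dec x = some m := by
  have h := (PMF.apply_eq_one_iff _ _).1 (C.correct m)
  have h2 : C.dec x ∈ ((C.enc m).map C.dec).support :=
    (PMF.mem_support_map_iff _ _ _).2 ⟨x, hx, rfl⟩
  rwa [h] at h2

theorem length_le (C : CodingScheme k n) : k ≤ n := by
  have h : (Finset.univ : Finset (Word k)).map Function.Embedding.some ⊆
      Finset.univ.image C.dec := by
    intro o ho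
    rw [Finset.mem_map] at ho
    obtain ⟨m, -, rfl⟩ := ho
    obtain ⟨x, hx⟩ := (C.enc m).support_nonempty
    exact Finset.mem_image.2 ⟨x, Finset.mem_univ _, C.dec_of_mem_support hx⟩
  have h2 := (Finset.card_le_card h).trans Finset.card_image_le
  rw [Finset.card_map] at h2
  simp only [Finset.card_univ, Fintype.card_fun, Fintype.card_fin, Fintype.card_bool] at h2
  exact (Nat.pow_le_pow_iff_right (by norm_num)).1 h2

variable {C} in
theorem IsStronglyNonMalleable.mono {𝓕 : Set (Word n → Word n)} {ε ε' : ℝ}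
    (h : C.IsStronglyNonMalleable 𝓕 ε) (hε : ε ≤ ε') : C.IsStronglyNonMalleable 𝓕 ε' :=
  fun m₀ m₁ f hf => (h m₀ m₁ f hf).trans hε

/-- The scheme that uses only those messages of `C` that encode shorter messages. -/
noncomputable def shorten {j : ℕ} (e : Word j ↪ Word k) : CodingScheme j n where
  enc m := C.enc (e m)
  dec x := (C.dec x).bind (Function.partialInv e)
  correct m := by
    have hsupp : ∀ x ∈ (C.enc (e m)).support,
        (C.dec x).bind (Function.partialInv e) = some m := by
      intro x hx
      rw [C.dec_of_mem_support hx, Option.bind_some, Function.partialInv_left e.injective]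
    rw [PMF.apply_eq_one_iff]
    ext o
    rw [PMF.mem_support_map_iff, Set.mem_singleton_iff]
    constructor
    · rintro ⟨x, hx, rfl⟩
      exact hsupp x hx
    · rintro rfl
      obtain ⟨x, hx⟩ := (C.enc (e m)).support_nonempty
      exact ⟨x, hx, hsupp x hx⟩

/-- The experiment for the shortened scheme is a function of that for the original one. -/
theorem strongNM_shorten {j : ℕ} (e : Word j ↪ Word k) (f : Word n → Word n) (m : Word j) :
    (C.shorten e).strongNM f m =
      (C.strongNM f (e m)).map (Option.map fun o => o.bind (Function.partialInv e)) := by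
  unfold strongNM
  rw [PMF.map_comp]
  congr 1
  funext x
  simp only [Function.comp]
  split_ifs <;> rfl

theorem exists_shorten {j : ℕ} (hj : j ≤ k) : ∃ C' : CodingScheme j n,
    ∀ 𝓕 ε, C.IsStronglyNonMalleable 𝓕 ε → C'.IsStronglyNonMalleable 𝓕 ε := by
  obtain ⟨e⟩ : Nonempty (Word j ↪ Word k) := by
    apply Function.Embedding.nonempty_of_card_le
    simp only [Fintype.card_fun, Fintype.card_fin, Fintype.card_bool]
    exact Nat.pow_le_pow_right (by norm_num) hj
  refine ⟨C.shorten e, fun 𝓕 ε h m₀ m₁ f hf => ?_⟩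
  rw [strongNM_shorten, strongNM_shorten]
  exact (statDist_map_le _ _ _).trans (h _ _ f hf)

theorem tamper_flip_eq_self_iff {S Sw : Finset (Fin n)} (hSw : Sw.Nonempty)
    (T : Finset ({i // i ∈ S} → Bool)) [DecidablePred (· ∈ T)] (x : Word n) :
    tamper S Sw (fun a _ => if a ∈ T then BitFn.flip else BitFn.keep) x = x ↔
      restrict S x ∉ T := by
  have hr : (fun j : {i // i ∈ S} => x j.1) = restrict S x := rfl
  constructor
  · intro h hT
    obtain ⟨i, hi⟩ := hSw
    have := congrFun h i
    simp only [tamper, hr, dif_pos hi, if_pos hT, BitFn.apply] at this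
    simp at this
  · intro hT
    funext i
    simp only [tamper, hr, if_neg hT, BitFn.apply]
    simp

theorem toReal_strongNM_none {f : Word n → Word n} {S : Finset (Fin n)}
    [DecidableEq ({i // i ∈ S} → Bool)]
    {T : Finset ({i // i ∈ S} → Bool)} (hf : ∀ x, f x = x ↔ restrict S x ∉ T) (m : Word k) :
    (C.strongNM f m none).toReal = ∑ s ∈ Tᶜ, (((C.enc m).map (restrict S)) s).toReal := by
  classical
  unfold strongNM
  rw [toReal_map_apply]
  simp_rw [toReal_map_apply]
  rw [Finset.sum_comm]
  refine Finset.sum_congr rfl fun x _ => ?_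
  rw [Finset.sum_ite_eq (Tᶜ) (restrict S x)]
  by_cases h : f x = x
  · have := (hf x).1 h
    simp [h, this]
  · have : restrict S x ∈ T := by
      by_contra hT
      exact h ((hf x).2 hT)
    simp [h, this]

/-- The bits at `S` leave at most `2 ^ (n - |S|)` possible messages, since every word decodes to at
most one message. -/
theorem card_filter_restrict_ne_zero_le (S : Finset (Fin n)) (s : {i // i ∈ S} → Bool) :
    (Finset.univ.filter fun m => (((C.enc m).map (restrict S)) s).toReal ≠ 0).card ≤
      2 ^ (n - S.card) := by
  classical
  rw [← card_cube S fun i => if h : i ∈ S then s ⟨i, h⟩ else false, ← filter_restrict_eq]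
  have h : (Finset.univ.filter fun m => (((C.enc m).map (restrict S)) s).toReal ≠ 0).map
      Function.Embedding.some ⊆ (Finset.univ.filter fun x => restrict S x = s).image C.dec := by
    intro o ho
    rw [Finset.mem_map] at ho
    obtain ⟨m, hm, rfl⟩ := ho
    have hm2 := (Finset.mem_filter.1 hm).2
    have hs : s ∈ ((C.enc m).map (restrict S)).support := by
      rw [PMF.mem_support_iff]
      intro h0
      rw [h0] at hm2
      exact hm2 rfl
    obtain ⟨x, hx, hxs⟩ := (PMF.mem_support_map_iff _ _ _).1 hs
    exact Finset.mem_image.2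
      ⟨x, Finset.mem_filter.2 ⟨Finset.mem_univ _, hxs⟩, C.dec_of_mem_support hx⟩
  have h2 := (Finset.card_le_card h).trans Finset.card_image_le
  rwa [Finset.card_map] at h2

variable {C} in
/-- The message length of a secure scheme exceeds the number of unread bits by at most
`log₂ (1 / (1 - ε))`. -/
theorem IsStronglyNonMalleable.mul_two_pow_le {ρr ρw ε : ℝ}
    (h : C.IsStronglyNonMalleable (bitTamperingWithLeakage n ρr ρw) ε)
    (hr : ⌊ρr * n⌋₊ ≤ n) (hw1 : 1 ≤ ⌊ρw * n⌋₊) (hw : ⌊ρw * n⌋₊ ≤ n) :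
    (1 - ε) * 2 ^ k ≤ 2 ^ (n - ⌊ρr * n⌋₊) := by
  classical
  obtain ⟨S, hS⟩ : ∃ S : Finset (Fin n), S.card = ⌊ρr * n⌋₊ := by
    obtain ⟨S, -, hS⟩ := Finset.exists_subset_card_eq (s := (Finset.univ : Finset (Fin n)))
      (by simpa using hr)
    exact ⟨S, hS⟩
  obtain ⟨Sw, hSw⟩ : ∃ S : Finset (Fin n), S.card = ⌊ρw * n⌋₊ := by
    obtain ⟨S, -, hS⟩ := Finset.exists_subset_card_eq (s := (Finset.univ : Finset (Fin n)))
      (by simpa using hw)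
    exact ⟨S, hS⟩
  have hSwne : Sw.Nonempty := Finset.card_pos.1 (by omega)
  set P : Word k → ({i // i ∈ S} → Bool) → ℝ :=
    fun m s => (((C.enc m).map (restrict S)) s).toReal with hP
  have hP0 : ∀ m s, 0 ≤ P m s := fun m s => ENNReal.toReal_nonneg
  have hP1 : ∀ m, ∑ s, P m s = 1 := fun m => sum_toReal_pmf _
  set m₀ : Word k := fun _ => false
  -- Tampering when the bits read are in the set where `P m₀` exceeds `P m` makes the difference of the
  -- probabilities of `same*` equal to the statistical distance of `P m` and `P m₀`.
  have hoverlap : ∀ m, 1 - ε ≤ ∑ s, min (P m s) (P m₀ s) := by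
    intro m
    set T : Finset ({i // i ∈ S} → Bool) := Finset.univ.filter fun s => P m s < P m₀ s with hT
    have hf := tamper_flip_eq_self_iff (S := S) hSwne T
    have h1 := (sub_le_statDist _ _ none).trans (h m₀ m _ ⟨S, Sw, hS, hSw,
      fun a _ => if a ∈ T then BitFn.flip else BitFn.keep, rfl⟩)
    rw [C.toReal_strongNM_none hf m, C.toReal_strongNM_none hf m₀] at h1
    have h2 : ∑ s ∈ T, P m s + ∑ s ∈ Tᶜ, P m s = 1 := by
      rw [Finset.sum_add_sum_compl, hP1]
    have h3 : ∑ s, min (P m s) (P m₀ s) = ∑ s ∈ T, P m s + ∑ s ∈ Tᶜ, P m₀ s := by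
      rw [← Finset.sum_add_sum_compl T]
      congr 1
      · refine Finset.sum_congr rfl fun s hs => min_eq_left ?_
        exact (Finset.mem_filter.1 hs).2.le
      · refine Finset.sum_congr rfl fun s hs => min_eq_right ?_
        rw [Finset.mem_compl, hT, Finset.mem_filter] at hs
        exact not_lt.1 fun hlt => hs ⟨Finset.mem_univ _, hlt⟩
    rw [h3]
    linarith
  calc (1 - ε) * 2 ^ k = ∑ _m : Word k, (1 - ε) := by
        rw [Finset.sum_const, Finset.card_univ, nsmul_eq_mul, mul_comm]
        simp
    _ ≤ ∑ m : Word k, ∑ s, min (P m s) (P m₀ s) := Finset.sum_le_sum fun m _ => hoverlap m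
    _ = ∑ s, ∑ m : Word k, min (P m s) (P m₀ s) := Finset.sum_comm
    _ ≤ ∑ s, 2 ^ (n - ⌊ρr * n⌋₊) * P m₀ s := by
        refine Finset.sum_le_sum fun s _ => ?_
        calc ∑ m : Word k, min (P m s) (P m₀ s)
            ≤ ∑ m : Word k, if P m s ≠ 0 then P m₀ s else 0 := by
              refine Finset.sum_le_sum fun m _ => ?_
              split_ifs with hm
              · exact min_le_right _ _
              · rw [not_not.1 hm]; exact min_le_left _ _
          _ = (Finset.univ.filter fun m => P m s ≠ 0).card * P m₀ s := by
              rw [← Finset.sum_filter, Finset.sum_const, nsmul_eq_mul]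
          _ ≤ 2 ^ (n - ⌊ρr * n⌋₊) * P m₀ s := by
              refine mul_le_mul_of_nonneg_right ?_ (hP0 _ _)
              have := C.card_filter_restrict_ne_zero_le S s
              rw [hS] at this
              exact_mod_cast this
    _ = 2 ^ (n - ⌊ρr * n⌋₊) := by rw [← Finset.mul_sum, hP1, mul_one]

end CodingScheme

/-! ### Rates of families -/

theorem floor_mul_natCast_le {ρ : ℝ} (hρ : ρ ≤ 1) (n : ℕ) : ⌊ρ * n⌋₊ ≤ n := by
  refine (Nat.floor_le_floor (b := (n : ℝ)) ?_).trans (Nat.floor_natCast n).le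
  exact mul_le_of_le_one_left (Nat.cast_nonneg n) hρ

namespace CodeFamily

theorem rate_eq_ofReal (C : CodeFamily) {k : ℕ} (hk : 0 < C.n k) :
    C.rate k = ENNReal.ofReal ((k : ℝ) / C.n k) := by
  rw [ENNReal.ofReal_div_of_pos (by exact_mod_cast hk), ENNReal.ofReal_natCast,
    ENNReal.ofReal_natCast, rate]

/-- The converse holds for each fixed `ε < 1`: the loss `log₂ (1 / (1 - ε))`, here rounded up to `c`,
does not affect the rate. -/
theorem achievedRate_le (C : CodeFamily) {ρr ρw ε : ℝ} (hr1 : ρr ≤ 1)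
    (hw0 : 0 < ρw) (hw1 : ρw ≤ 1) (hε : ε < 1)
    (h : ∀ᶠ k in atTop, (C.scheme k).IsStronglyNonMalleable
      (bitTamperingWithLeakage (C.n k) ρr ρw) ε) :
    C.achievedRate ≤ ENNReal.ofReal (1 - ρr) := by
  obtain ⟨c, hc⟩ := exists_pow_lt_of_lt_one (show (0 : ℝ) < 1 - ε by linarith)
    (show (1 / 2 : ℝ) < 1 by norm_num)
  have hlim : Tendsto (fun k : ℕ => ENNReal.ofReal (1 - ρr + (1 + c) / (k : ℝ))) atTop
      (𝓝 (ENNReal.ofReal (1 - ρr))) := by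
    refine ENNReal.tendsto_ofReal ?_
    simpa using (tendsto_const_div_atTop_nhds_zero_nat (1 + c : ℝ)).const_add (1 - ρr)
  rw [achievedRate, ← hlim.limsup_eq]
  refine limsup_le_limsup ?_
  obtain ⟨k₀, hk₀⟩ := exists_nat_ge (1 / ρw)
  filter_upwards [h, eventually_ge_atTop (k₀ + 1)] with k hk hkk
  have hkn := (C.scheme k).length_le
  have hk0 : (0 : ℝ) < k := by exact_mod_cast (by omega : 0 < k)
  have hn0 : (0 : ℝ) < C.n k := by exact_mod_cast (by omega : 0 < C.n k)
  have hknR : (k : ℝ) ≤ C.n k := by exact_mod_cast hkn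
  have hwn : 1 ≤ ⌊ρw * C.n k⌋₊ := by
    rw [Nat.one_le_floor_iff, mul_comm, ← div_le_iff₀ hw0]
    refine hk₀.trans (le_trans ?_ hknR)
    exact_mod_cast (by omega : k₀ ≤ k)
  have hrn := floor_mul_natCast_le hr1 (C.n k)
  have h1 := hk.mul_two_pow_le hrn hwn (floor_mul_natCast_le hw1 _)
  have h2 : k ≤ C.n k - ⌊ρr * C.n k⌋₊ + c := by
    rw [← Nat.pow_le_pow_iff_right (a := 2) (by norm_num)]
    have h3 : (1 / 2 : ℝ) ^ c * 2 ^ k ≤ 2 ^ (C.n k - ⌊ρr * C.n k⌋₊) :=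
      (mul_le_mul_of_nonneg_right hc.le (by positivity)).trans h1
    have h4 : (2 : ℝ) ^ k ≤ 2 ^ (C.n k - ⌊ρr * C.n k⌋₊ + c) := by
      calc (2 : ℝ) ^ k = ((1 / 2 : ℝ) ^ c * 2 ^ k) * 2 ^ c := by
            rw [mul_right_comm, ← mul_pow]; norm_num
        _ ≤ 2 ^ (C.n k - ⌊ρr * C.n k⌋₊) * 2 ^ c := by gcongr
        _ = _ := (pow_add _ _ _).symm
    exact_mod_cast h4
  have h5 : (k : ℝ) ≤ C.n k - ⌊ρr * C.n k⌋₊ + c := by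
    rw [← Nat.cast_sub hrn]; exact_mod_cast h2
  have h6 := Nat.lt_floor_add_one (ρr * C.n k)
  rw [C.rate_eq_ofReal (by omega)]
  refine ENNReal.ofReal_le_ofReal ?_
  rw [div_le_iff₀ hn0, add_mul]
  have h7 : (1 + c : ℝ) ≤ (1 + c) / k * C.n k := by
    rw [div_mul_eq_mul_div, le_div_iff₀ hk0]
    gcongr
  linarith

end CodeFamily

/-- Only large message lengths matter: the scheme for a short message length is obtained from a
scheme for a larger one. -/
theorem exists_codeFamily {ρr ρw : ℝ} (N : ℕ → ℕ) (e : ℕ → ℝ) (k₀ : ℕ)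
    (h : ∀ k, k₀ ≤ k → ∃ C : CodingScheme k (N k),
      C.IsStronglyNonMalleable (bitTamperingWithLeakage (N k) ρr ρw) (e k)) :
    ∃ C : CodeFamily, (∀ k, C.n k = N (max k k₀)) ∧
      C.IsStrongNMC ρr ρw fun k => e (max k k₀) := by
  have h1 : ∀ k, ∃ C : CodingScheme k (N (max k k₀)), C.IsStronglyNonMalleable
      (bitTamperingWithLeakage (N (max k k₀)) ρr ρw) (e (max k k₀)) := by
    intro k
    obtain ⟨C, hC⟩ := h (max k k₀) (le_max_right _ _)
    obtain ⟨C', hC'⟩ := C.exists_shorten (le_max_left k k₀)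
    exact ⟨C', hC' _ _ hC⟩
  choose C hC using h1
  exact ⟨⟨fun k => N (max k k₀), C⟩, fun _ => rfl, hC⟩

/-- The number `n - ⌊ρr * n⌋` of unread bits grows by at most one with `n` and is unbounded, so it
takes every value. -/
theorem exists_sub_floor_eq {ρr : ℝ} (hr0 : 0 ≤ ρr) (hr1 : ρr < 1) (j : ℕ) :
    ∃ n : ℕ, ⌊ρr * n⌋₊ + j = n := by
  have hunb : ∀ j : ℕ, ∃ n : ℕ, ⌊ρr * n⌋₊ + j ≤ n := by
    intro j
    obtain ⟨n, hn⟩ := exists_nat_ge (j / (1 - ρr))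
    rw [div_le_iff₀ (by linarith)] at hn
    refine ⟨n, ?_⟩
    have h1 := Nat.floor_le (mul_nonneg hr0 (Nat.cast_nonneg (α := ℝ) n))
    have h2 : ((⌊ρr * n⌋₊ + j : ℕ) : ℝ) ≤ n := by push_cast; linarith
    exact_mod_cast h2
  classical
  have hn := Nat.find_spec (hunb j)
  rcases hn0 : Nat.find (hunb j) with _ | n
  · rw [hn0] at hn
    exact ⟨0, by omega⟩
  · have hlt := Nat.find_min (hunb j) (m := n) (by omega)
    rw [hn0] at hn
    refine ⟨n + 1, ?_⟩
    have hmono : ⌊ρr * n⌋₊ ≤ ⌊ρr * (n + 1 : ℕ)⌋₊ := by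
      refine Nat.floor_le_floor ?_
      push_cast
      nlinarith
    omega

theorem tendsto_natSqrt_atTop : Tendsto Nat.sqrt atTop atTop := by
  refine tendsto_atTop.2 fun b => ?_
  filter_upwards [eventually_ge_atTop (b * b)] with k hk
  exact Nat.le_sqrt.2 hk

theorem tendsto_sq_mul_half_pow (A : ℝ) :
    Tendsto (fun s : ℕ => A * (s + 1) ^ 2 * (1 / 2) ^ s) atTop (𝓝 0) := by
  have h := (tendsto_pow_const_mul_const_pow_of_abs_lt_one 2
    (show |(1 / 2 : ℝ)| < 1 by norm_num [abs_of_pos])).comp (tendsto_add_atTop_nat 1)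
  have h2 := h.const_mul (2 * A)
  rw [mul_zero] at h2
  refine h2.congr fun s => ?_
  simp only [Function.comp]
  push_cast
  rw [pow_succ]
  ring

theorem two_pow_mul_exp_lt_one {m : ℕ} {y : ℝ} (h : (m : ℝ) < y) :
    (2 : ℝ) ^ m * Real.exp (-y) < 1 := by
  have h1 : (2 : ℝ) ≤ Real.exp 1 := by have := Real.add_one_le_exp (1 : ℝ); linarith
  calc (2 : ℝ) ^ m * Real.exp (-y) ≤ Real.exp 1 ^ m * Real.exp (-y) := by gcongr
    _ = Real.exp (m - y) := by rw [← Real.exp_nat_mul, mul_one, ← Real.exp_add, sub_eq_add_neg]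
    _ < 1 := Real.exp_lt_one_iff.2 (by linarith)

theorem exists_codeFamily_tendsto_rate {ρr : ℝ} (ρw : ℝ) (hr0 : 0 ≤ ρr) (hr1 : ρr < 1) :
    ∃ (C : CodeFamily) (ε : ℕ → ℝ), Tendsto ε atTop (𝓝 0) ∧ C.IsStrongNMC ρr ρw ε ∧
      Tendsto C.rate atTop (𝓝 (ENNReal.ofReal (1 - ρr))) := by
  have hρ : 0 < 1 - ρr := by linarith
  choose N hN using fun k => exists_sub_floor_eq hr0 hr1 (k + 8 * k.sqrt)
  have hNlow : ∀ k, (1 - ρr) * N k ≤ k + 8 * k.sqrt := by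
    intro k
    have h2 := Nat.floor_le (mul_nonneg hr0 (Nat.cast_nonneg (α := ℝ) (N k)))
    have h3 : (⌊ρr * N k⌋₊ : ℝ) + (k + 8 * k.sqrt) = N k := by exact_mod_cast hN k
    linarith
  have hNup : ∀ k : ℕ, (k : ℝ) + 8 * k.sqrt ≤ (1 - ρr) * N k + 1 := by
    intro k
    have h1 := Nat.lt_floor_add_one (ρr * N k)
    have h3 : (⌊ρr * N k⌋₊ : ℝ) + (k + 8 * k.sqrt) = N k := by exact_mod_cast hN k
    linarith
  have hkN : ∀ k : ℕ, k ≤ N k := fun k => by have := hN k; omega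
  set A : ℝ := 144 / (1 - ρr) + 4 with hA
  have hNA : ∀ k, 16 * (N k : ℝ) + 4 ≤ A * (k.sqrt + 1) ^ 2 := by
    intro k
    have h1 : (k : ℝ) ≤ (k.sqrt + 1) ^ 2 := by
      have := (Nat.lt_succ_sqrt k).le
      rw [sq]
      exact_mod_cast this
    have h2 : (N k : ℝ) ≤ 9 / (1 - ρr) * (k.sqrt + 1) ^ 2 := by
      rw [div_mul_eq_mul_div, le_div_iff₀ hρ]
      have h3 : (0 : ℝ) ≤ k.sqrt := Nat.cast_nonneg _
      nlinarith [hNlow k]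
    have h4 : (1 : ℝ) ≤ (k.sqrt + 1) ^ 2 :=
      one_le_pow₀ (by have : (0 : ℝ) ≤ k.sqrt := Nat.cast_nonneg _
                      linarith)
    calc 16 * (N k : ℝ) + 4 ≤ 16 * (9 / (1 - ρr) * (k.sqrt + 1) ^ 2) + 4 * (k.sqrt + 1) ^ 2 := by
          linarith
      _ = A * (k.sqrt + 1) ^ 2 := by rw [hA]; ring
  set e : ℕ → ℝ := fun k => (16 * N k + 4) * (1 / 2) ^ k.sqrt with he
  have hG := (tendsto_sq_mul_half_pow A).comp tendsto_natSqrt_atTop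
  have he0 : Tendsto e atTop (𝓝 0) := by
    refine squeeze_zero (fun k => by positivity) (fun k => ?_) hG
    exact mul_le_mul_of_nonneg_right (hNA k) (by positivity)
  have hev : ∀ᶠ k in atTop, ∃ C : CodingScheme k (N k),
      C.IsStronglyNonMalleable (bitTamperingWithLeakage (N k) ρr ρw) (e k) := by
    filter_upwards [hG.eventually (gt_mem_nhds (show (0 : ℝ) < 1 / 4 by norm_num)),
      tendsto_natSqrt_atTop.eventually_ge_atTop 1] with k hk hk1
    have hk2 : A * (k.sqrt + 1) ^ 2 < 2 ^ k.sqrt / 4 := by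
      have h2 : (0 : ℝ) < 2 ^ k.sqrt := by positivity
      calc A * (k.sqrt + 1) ^ 2 = A * (k.sqrt + 1) ^ 2 * (1 / 2) ^ k.sqrt * 2 ^ k.sqrt := by
            rw [mul_assoc (A * _), ← mul_pow]; norm_num
        _ < 1 / 4 * 2 ^ k.sqrt := mul_lt_mul_of_pos_right hk h2
        _ = _ := by ring
    have hk3 : (2 : ℝ) ^ k.sqrt ≤ 4 ^ k.sqrt := by gcongr; norm_num
    obtain ⟨C, hC⟩ := exists_codingScheme (k := k) (u := k.sqrt) (r := ⌊ρr * N k⌋₊) (n := N k)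
      (by have := hN k; omega)
      (two_pow_mul_exp_lt_one (by
        push_cast
        have := hNA k
        have : (0 : ℝ) ≤ N k := Nat.cast_nonneg _
        linarith)) hk1
    exact ⟨C, hC ρr ρw rfl⟩
  obtain ⟨k₀, hk₀⟩ := eventually_atTop.1 hev
  obtain ⟨C, hCn, hC⟩ := exists_codeFamily N e k₀ hk₀
  have hmax : Tendsto (fun k => max k k₀) atTop atTop :=
    tendsto_atTop_mono (fun k => le_max_left k k₀) tendsto_id
  refine ⟨C, _, he0.comp hmax, hC, ?_⟩
  have hreal : Tendsto (fun k : ℕ => (k : ℝ) / N k) atTop (𝓝 (1 - ρr)) := by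
    have hlow : Tendsto (fun k : ℕ => 1 - ρr - 8 / (k.sqrt : ℝ)) atTop (𝓝 (1 - ρr)) := by
      simpa using ((tendsto_const_div_atTop_nhds_zero_nat (8 : ℝ)).comp
        tendsto_natSqrt_atTop).const_sub (1 - ρr)
    have hup : Tendsto (fun k : ℕ => 1 - ρr + 1 / (k : ℝ)) atTop (𝓝 (1 - ρr)) := by
      simpa using (tendsto_const_div_atTop_nhds_zero_nat (1 : ℝ)).const_add (1 - ρr)
    refine tendsto_of_tendsto_of_tendsto_of_le_of_le' hlow hup ?_ ?_
    · filter_upwards [eventually_ge_atTop 1] with k hk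
      have hs : 0 < k.sqrt := Nat.sqrt_pos.2 hk
      have hsR : (0 : ℝ) < k.sqrt := by exact_mod_cast hs
      have hN0 : (0 : ℝ) < N k := by exact_mod_cast (by have := hkN k; omega : 0 < N k)
      have hsN : (k.sqrt : ℝ) * k.sqrt ≤ N k := by
        exact_mod_cast (Nat.sqrt_le k).trans (hkN k)
      rw [le_div_iff₀ hN0, sub_mul]
      have h1 : 8 * (k.sqrt : ℝ) ≤ 8 / k.sqrt * N k := by
        rw [div_mul_eq_mul_div, le_div_iff₀ hsR]
        nlinarith
      linarith [hNlow k]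
    · filter_upwards [eventually_ge_atTop 1] with k hk
      have hk0 : (0 : ℝ) < k := by exact_mod_cast hk
      have hN0 : (0 : ℝ) < N k := by exact_mod_cast (by have := hkN k; omega : 0 < N k)
      have hkNR : (k : ℝ) ≤ N k := by exact_mod_cast hkN k
      rw [div_le_iff₀ hN0, add_mul]
      have h1 : (1 : ℝ) ≤ 1 / k * N k := by
        rw [div_mul_eq_mul_div, le_div_iff₀ hk0]
        linarith
      have hs : (0 : ℝ) ≤ k.sqrt := Nat.cast_nonneg _
      linarith [hNup k]
  refine (ENNReal.tendsto_ofReal hreal).congr' ?_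
  filter_upwards [eventually_ge_atTop (k₀ + 1)] with k hk
  have hn : C.n k = N k := by rw [hCn, max_eq_left (by omega)]
  rw [C.rate_eq_ofReal (by have := hkN k; omega), hn]

theorem exists_codeFamily_const {ρr ρw ε : ℝ} (hr0 : 0 ≤ ρr) (hr1 : ρr < 1) (hε : 0 < ε) :
    ∃ C : CodeFamily, (C.IsStrongNMC ρr ρw fun _ => ε) ∧
      C.achievedRate = ENNReal.ofReal (1 - ρr) := by
  obtain ⟨C, e, he, hC, hrate⟩ := exists_codeFamily_tendsto_rate ρw hr0 hr1
  obtain ⟨k₀, hk₀⟩ := eventually_atTop.1 (he.eventually (gt_mem_nhds hε))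
  obtain ⟨C', hn, hC'⟩ := exists_codeFamily C.n (fun _ => ε) k₀
    fun k hk => ⟨C.scheme k, (hC k).mono (hk₀ k hk).le⟩
  refine ⟨C', hC', Tendsto.limsup_eq (hrate.congr' ?_)⟩
  filter_upwards [eventually_ge_atTop k₀] with k hk
  rw [CodeFamily.rate, CodeFamily.rate, hn, max_eq_left hk]

end NMCode

theorem theorem3p1 (ρr ρw : ℝ) (hr0 : 0 ≤ ρr) (hr1 : ρr ≤ 1) (hw0 : 0 < ρw) (hw1 : ρw ≤ 1) :
    NMCode.strongCapacity ρr ρw = ENNReal.ofReal (1 - ρr) ∧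
    (∀ ε : ℝ, 0 < ε → ε < 1 →
      NMCode.strongCapacityWithError ρr ρw ε = ENNReal.ofReal (1 - ρr)) ∧
    (ρr < 1 → ∃ (C : NMCode.CodeFamily) (ε : ℕ → ℝ), Tendsto ε atTop (𝓝 0) ∧
      C.IsStrongNMC ρr ρw ε ∧ Tendsto C.rate atTop (𝓝 (ENNReal.ofReal (1 - ρr)))) := by
  refine ⟨le_antisymm ?_ ?_, fun ε hε0 hε1 => le_antisymm ?_ ?_, fun hr => ?_⟩
  · refine iSup₂_le fun C hC => ?_
    obtain ⟨ε, hε, h⟩ := hC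
    refine C.achievedRate_le hr1 hw0 hw1 (show (1 / 2 : ℝ) < 1 by norm_num) ?_
    filter_upwards [hε.eventually (gt_mem_nhds (show (0 : ℝ) < 1 / 2 by norm_num))] with k hk
    exact (h k).mono hk.le
  · rcases hr1.eq_or_lt with rfl | hr
    · simp
    · obtain ⟨C, ε, hε, h, hrate⟩ := NMCode.exists_codeFamily_tendsto_rate ρw hr0 hr
      rw [← hrate.limsup_eq]
      exact le_iSup₂_of_le C ⟨ε, hε, h⟩ le_rfl
  · refine iSup₂_le fun C hC => ?_
    exact C.achievedRate_le hr1 hw0 hw1 hε1 (Eventually.of_forall hC)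
  · rcases hr1.eq_or_lt with rfl | hr
    · simp
    · obtain ⟨C, h, hrate⟩ := NMCode.exists_codeFamily_const (ρw := ρw) hr0 hr hε0
      rw [← hrate]
      exact le_iSup₂_of_le C h le_rfl
  · exact NMCode.exists_codeFamily_tendsto_rate ρw hr0 hr
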